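/- Let $Z_1, Z_2, \ldots$ be independent, identically distributed random vectors in $\mathbb{R}^2$ with $\mathbb{E}\|Z_1\|^2 < \infty$ and $\mathbb{E} Z_1 \neq 0$. Let $S_0 = 0$ and $S_n = \sum_{i=1}^n Z_i$, and let $L_n$ be the perimeter length of the convex hull of $\{S_0, \ldots, S_n\}$, where the perimeter length of a line segment is taken to be twice its length (and that of a point to be $0$). Suppose that $$\sigma^2 := \frac{4\,\mathbb{E}\big[\big((Z_1 - \mathbb{E} Z_1)\cdot \mathbb{E} Z_1\big)^2\big]}{\|\mathbb{E} Z_1\|^2} > 0 .$$ Then $\mathbb{E}[L_n^2] < \infty$ for every $n$, and for every $x \in \mathbb{R}$, $$\lim_{n\to\infty} \mathbb{P}\left[\frac{L_n - \mathbb{E} L_n}{\sqrt{\operatorname{Var}[L_n]}} \le x\right] = \lim_{n\to\infty} \mathbb{P}\left[\frac{L_n - \mathbb{E} L_n}{\sqrt{\sigma^2 n}} \le x\right] = \Phi(x),$$ where $\Phi$ is the distribution function of the standard normal distribution. -/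

import Mathlib

open MeasureTheory ProbabilityTheory Filter
open scoped Topology

noncomputable section

/-- The Euclidean plane. -/
abbrev Plane : Type := EuclideanSpace ℝ (Fin 2)

/-- The random walk `S_n = Z_1 + ... + Z_n` with `S_0 = 0`. The increments are indexed from `0`:
`Z i` is the increment of step number `i + 1`. -/
def walk {Ω : Type*} (Z : ℕ → Ω → Plane) (n : ℕ) (ω : Ω) : Plane :=
  ∑ i ∈ Finset.range n, Z i ω

/-- The convex hull of the positions `S_0, ..., S_n` of the walk. -/
def walkHull {Ω : Type*} (Z : ℕ → Ω → Plane) (n : ℕ) (ω : Ω) : Set Plane :=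
  convexHull ℝ ((fun j => walk Z j ω) '' Set.Iic n)

open Classical in
/-- The perimeter length of a planar compact convex set `K`. If `K` has interior points, this is
the length (one-dimensional Hausdorff measure, for which a segment has its usual length) of the
boundary of `K`. If `K` has no interior points, it is a segment, possibly a point; then, by the
usual convention, the boundary curve runs through it back and forth, and the perimeter is twice
its length. -/
def perimeter (K : Set Plane) : ℝ :=
  if (interior K).Nonempty then (Measure.hausdorffMeasure 1 (frontier K)).toReal
  else 2 * (Measure.hausdorffMeasure 1 K).toReal

/-- `L_n`, the perimeter length of the convex hull of `S_0, ..., S_n`. -/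
def hullPerimeter {Ω : Type*} (Z : ℕ → Ω → Plane) (n : ℕ) (ω : Ω) : ℝ :=
  perimeter (walkHull Z n ω)

/-- `σ² = 4 E[((X - E X) · E X)²] / ‖E X‖²`, for a random vector `X` of non-zero mean. -/
def sigmaSq {Ω : Type*} [MeasurableSpace Ω] (P : Measure Ω) (X : Ω → Plane) : ℝ :=
  4 * (∫ ω, (inner ℝ (X ω - ∫ ω', X ω' ∂P) (∫ ω', X ω' ∂P)) ^ 2 ∂P) / ‖∫ ω, X ω ∂P‖ ^ 2

end

/-! ### Convex bodies: frontier measure under inclusion, stability of the hull. -/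

section ConvexGeometry

variable {E : Type*} [NormedAddCommGroup E] [InnerProductSpace ℝ E]

/-! Let `m • u` be the mean step, with `‖u‖ = 1` and `m > 0`. The hull of a walk with drift is long
and thin, so its perimeter is close to twice its extent along `u`, which is close to `2 u · S_n`, a
sum of i.i.d. real variables of variance `σ²`. The core of the proof is that `L_n - 2 u · S_n` has
second moment `o(n)`. Then `Var L_n / n → σ²` by Cauchy–Schwarz, and both limits follow from the
classical central limit theorem and Slutsky's lemma.

The difference is nonnegative, because a perimeter is at least twice any chord
(`two_mul_dist_le_perimeter`, with the chord from `S_0` to `S_n`).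

For the upper bound, the hull is enclosed in a hexagon with two long sides parallel to `u` at
heights `±M`, and sides of slope `±δ` leaving two tips, one behind `S_0` and one ahead of `S_n`.
Perimeter is monotone for convex bodies, and the slanted sides cost only second order in `δ`, so
`L_n ≤ 2 (a + b) + 3 δ M` (`perimeter_le_of_hexagon`). Here `M` is the maximal transversal
deviation: by Doob its second moment is `O(n)`, so `δ M` is harmless for small `δ`. The quantities
`a` and `b - u · S_n` are built from maximal excesses of centred walks, run forward and backward,
over lines of positive slope. Such an excess has second moment at most `ε n + C`
(`exists_integral_partialSups_excess_sq_le`): after truncation the bounded part has an excess with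
bounded second moment by sub-Gaussian tails, and the remainder has small variance. -/

theorem exists_ray_mem_frontier {Q : Set E} (hQ : Bornology.IsBounded Q) {p v : E} (hp : p ∈ Q)
    (hv : v ≠ 0) : ∃ t : ℝ, 0 ≤ t ∧ p + t • v ∈ frontier Q := by
  by_contra! h
  have hcont : Continuous fun t : ℝ => p + t • v := by fun_prop
  -- A ray missing the frontier is covered by the disjoint open sets `interior Q` and `(closure
  -- Q)ᶜ`; it meets both, as it starts in `Q` and leaves every bounded set. This contradicts its
  -- connectedness.
  have hcover : Set.Ici (0 : ℝ) ⊆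
      (fun t : ℝ => p + t • v) ⁻¹' interior Q ∪ (fun t : ℝ => p + t • v) ⁻¹' (closure Q)ᶜ := by
    intro t ht
    by_cases hc : p + t • v ∈ closure Q
    · left
      by_contra hi
      exact h t ht ⟨hc, hi⟩
    · exact Or.inr hc
  obtain ⟨C, hC⟩ := hQ.closure.exists_norm_le
  have hnv : 0 < ‖v‖ := norm_pos_iff.2 hv
  set t₀ : ℝ := (|C| + ‖p‖ + 1) / ‖v‖
  have ht₀ : 0 ≤ t₀ := by positivity
  have hout : p + t₀ • v ∉ closure Q := by
    intro hmem
    have h1 := hC _ hmem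
    have h2 : ‖t₀ • v‖ = |C| + ‖p‖ + 1 := by
      rw [norm_smul, Real.norm_of_nonneg ht₀]
      exact div_mul_cancel₀ _ hnv.ne'
    have h3 : ‖t₀ • v‖ ≤ ‖p + t₀ • v‖ + ‖p‖ := by
      simpa using norm_sub_le (p + t₀ • v) p
    have := le_abs_self C
    linarith
  have hin : p + (0 : ℝ) • v ∈ interior Q := by
    rcases hcover (Set.mem_Ici.2 le_rfl) with h0 | h0
    · exact h0
    · exact absurd (subset_closure (by simpa using hp)) h0
  obtain ⟨t, -, h1, h2⟩ := isPreconnected_Ici _ _ (isOpen_interior.preimage hcont)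
    (isClosed_closure.isOpen_compl.preimage hcont) hcover
    ⟨0, Set.mem_Ici.2 le_rfl, hin⟩ ⟨t₀, ht₀, hout⟩
  exact h2 (interior_subset_closure h1)

theorem exists_supporting_normal [CompleteSpace E] {K : Set E} (hK : Convex ℝ K)
    (hint : (interior K).Nonempty) {p : E} (hp : p ∉ interior K) :
    ∃ v : E, v ≠ 0 ∧ ∀ x ∈ K, inner ℝ v (x - p) ≤ 0 := by
  obtain ⟨f, hf, hle⟩ := geometric_hahn_banach_of_nonempty_interior_point hK hp hint
  refine ⟨(InnerProductSpace.toDual ℝ E).symm f, by simpa using hf, fun x hx => ?_⟩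
  rw [InnerProductSpace.toDual_symm_apply, map_sub]
  linarith [hle x hx]

/-- The boundary of a convex body is at most as long as that of a bounded set around it. -/
theorem hausdorffMeasure_frontier_mono [CompleteSpace E] [MeasurableSpace E] [BorelSpace E]
    {d : ℝ} (hd : 0 ≤ d) {K Q : Set E} (hK : Convex ℝ K) (hKc : IsClosed K)
    (hint : (interior K).Nonempty) (hKQ : K ⊆ Q) (hQ : Bornology.IsBounded Q) :
    Measure.hausdorffMeasure d (frontier K) ≤ Measure.hausdorffMeasure d (frontier Q) := by
  -- `R q p`: the vector `q - p` lies in the normal cone of `K` at `p`, as when `p` is the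
  -- nearest-point projection of `q`. This projection is 1-Lipschitz, and it maps a part of
  -- `frontier Q` onto `frontier K`.
  set R : E → E → Prop := fun q p => p ∈ frontier K ∧ ∀ x ∈ K, inner ℝ (q - p) (x - p) ≤ 0
  set A : Set E := {q ∈ frontier Q | ∃ p, R q p}
  choose! f hf using fun q (hq : q ∈ A) => hq.2
  have hlip : LipschitzOnWith 1 f A := by
    refine LipschitzOnWith.of_dist_le_mul fun q hq q' hq' => ?_
    rw [dist_eq_norm, dist_eq_norm, NNReal.coe_one, one_mul]
    have h1 := (hf q hq).2 (f q') (hKc.frontier_subset (hf q' hq').1)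
    have h2 := (hf q' hq').2 (f q) (hKc.frontier_subset (hf q hq).1)
    have h3 : inner ℝ (f q - f q') (f q - f q') ≤ inner ℝ (q - q') (f q - f q') := by
      have : inner ℝ (q - q') (f q - f q') - inner ℝ (f q - f q') (f q - f q')
          = - inner ℝ (q - f q) (f q' - f q) - inner ℝ (q' - f q') (f q - f q') := by
        rw [← neg_sub (f q) (f q'), inner_neg_right, neg_neg, ← inner_sub_left, ← inner_sub_left]
        congr 1
        abel
      linarith
    have h4 := real_inner_le_norm (q - q') (f q - f q')
    rw [real_inner_self_eq_norm_sq] at h3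
    by_contra! hlt
    nlinarith [norm_nonneg (q - q'), norm_nonneg (f q - f q')]
  have himg : frontier K ⊆ f '' A := by
    intro p hp
    obtain ⟨v, hv, hle⟩ := exists_supporting_normal hK hint hp.2
    obtain ⟨t, ht, hmem⟩ := exists_ray_mem_frontier hQ (hKQ (hKc.frontier_subset hp)) hv
    have hR : R (p + t • v) p := by
      refine ⟨hp, fun x hx => ?_⟩
      rw [add_sub_cancel_left, inner_smul_left]
      exact mul_nonpos_of_nonneg_of_nonpos (by simpa using ht) (hle x hx)
    have hA : p + t • v ∈ A := ⟨hmem, p, hR⟩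
    refine ⟨p + t • v, hA, ?_⟩
    -- `f` is a choice of foot; the variational inequalities at `p` and at the chosen foot force the
    -- two to coincide.
    have h1 := (hf _ hA).2 p (hKc.frontier_subset hp)
    have h2 := hR.2 _ (hKc.frontier_subset (hf _ hA).1)
    set r := f (p + t • v)
    have h3 : inner ℝ (r - p) (r - p) = inner ℝ (p + t • v - p) (r - p)
        + inner ℝ (p + t • v - r) (p - r) := by
      rw [← neg_sub r p, inner_neg_right, ← sub_eq_add_neg, ← inner_sub_left]
      congr 1
      abel
    have h4 : inner ℝ (r - p) (r - p) = 0 := le_antisymm (by linarith) real_inner_self_nonneg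
    exact sub_eq_zero.1 (inner_self_eq_zero.1 h4)
  calc Measure.hausdorffMeasure d (frontier K) ≤ Measure.hausdorffMeasure d (f '' A) :=
        measure_mono himg
    _ ≤ (1 : NNReal) ^ d * Measure.hausdorffMeasure d A := by
        exact_mod_cast hlip.hausdorffMeasure_image_le hd
    _ ≤ Measure.hausdorffMeasure d (frontier Q) := by
        simpa using measure_mono (fun q hq => hq.1)

/-- A small perturbation of the vertices keeps a slightly smaller ball inside the convex hull. -/
theorem ball_subset_convexHull_of_dist_lt [FiniteDimensional ℝ E] {ι : Type*} [Finite ι]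
    {x x' : ι → E} {y : E} {r : ℝ} (hr : 0 < r)
    (hball : Metric.ball y (2 * r) ⊆ convexHull ℝ (Set.range x)) (hx : ∀ i, dist (x' i) (x i) < r) :
    Metric.ball y r ⊆ convexHull ℝ (Set.range x') := by
  intro z hz
  by_contra hzn
  have hcl : IsClosed (convexHull ℝ (Set.range x')) :=
    (Set.finite_range x').isClosed_convexHull ℝ
  obtain ⟨f, u, hfu, huz⟩ := geometric_hahn_banach_closed_point (convex_convexHull ℝ _) hcl hzn
  set v : E := (InnerProductSpace.toDual ℝ E).symm f
  have hv : ∀ w, f w = inner ℝ v w := fun w => by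
    rw [InnerProductSpace.toDual_symm_apply]
  have hne : Nonempty ι := by
    by_contra hemp
    rw [not_nonempty_iff] at hemp
    have : y ∈ convexHull ℝ (Set.range x) := hball (Metric.mem_ball_self (by positivity))
    rwa [Set.range_eq_empty, convexHull_empty] at this
  have hv0 : 0 < ‖v‖ := by
    rw [norm_pos_iff]
    intro h0
    obtain ⟨i⟩ := hne
    have h1 := hfu (x' i) (subset_convexHull ℝ _ ⟨i, rfl⟩)
    rw [hv, h0, inner_zero_left] at h1
    rw [hv, h0, inner_zero_left] at huz
    linarith
  -- Moving `z` by `r` along the separating normal stays in the ball of radius `2 * r`, but takes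
  -- `f` above `u + r * ‖v‖`, which bounds `f` on the unperturbed hull.
  have hmem : z + (r / ‖v‖) • v ∈ convexHull ℝ (Set.range x) := by
    apply hball
    rw [Metric.mem_ball] at hz ⊢
    calc dist (z + (r / ‖v‖) • v) y ≤ dist (z + (r / ‖v‖) • v) z + dist z y := dist_triangle _ _ _
      _ < 2 * r := by
        rw [dist_eq_norm, add_sub_cancel_left, norm_smul, Real.norm_of_nonneg (by positivity),
          div_mul_cancel₀ _ hv0.ne']
        linarith
  have hhalf : convexHull ℝ (Set.range x) ⊆ {w | f w ≤ u + r * ‖v‖} := by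
    refine convexHull_min ?_ (convex_halfSpace_le f.toLinearMap.isLinear _)
    rintro _ ⟨i, rfl⟩
    have h1 := hfu (x' i) (subset_convexHull ℝ _ ⟨i, rfl⟩)
    have h2 : f (x i - x' i) ≤ ‖v‖ * ‖x i - x' i‖ := by
      rw [hv]
      exact real_inner_le_norm _ _
    have h3 : ‖x i - x' i‖ ≤ r := by
      rw [← dist_eq_norm, dist_comm]
      exact (hx i).le
    rw [map_sub] at h2
    have h4 := mul_le_mul_of_nonneg_left h3 hv0.le
    show f (x i) ≤ u + r * ‖v‖
    nlinarith
  have h5 := hhalf hmem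
  change f _ ≤ _ at h5
  rw [map_add, map_smul, hv v, real_inner_self_eq_norm_sq, smul_eq_mul] at h5
  have h6 : r / ‖v‖ * ‖v‖ ^ 2 = r * ‖v‖ := by
    field_simp
  linarith

end ConvexGeometry

/-! ### Lengths of boundary arcs and of Lipschitz graphs. -/

section Boundary

variable {E : Type*} [NormedAddCommGroup E] [InnerProductSpace ℝ E] [MeasurableSpace E]
  [BorelSpace E]

/-- The part of the boundary on one side of an interior segment is at least as long as this
segment. -/
theorem ofReal_le_hausdorffMeasure_frontier_inter {K : Set E} (hK : Convex ℝ K)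
    (hKb : Bornology.IsBounded K) {p e v : E} {l : ℝ} (he : ‖e‖ = 1) (hv : v ≠ 0)
    (hev : inner ℝ e v = 0) (hp : p ∈ interior K) (hq : p + l • e ∈ interior K) :
    ENNReal.ofReal l ≤
      Measure.hausdorffMeasure 1 (frontier K ∩ {x | 0 < inner ℝ v (x - p)}) := by
  rcases le_or_gt l 0 with hl | hl
  · simp [ENNReal.ofReal_of_nonpos hl]
  set g : E → ℝ := fun x => inner ℝ e (x - p)
  have hg : LipschitzWith 1 g := by
    refine LipschitzWith.of_dist_le_mul fun x y => ?_
    rw [Real.dist_eq, ← inner_sub_right, sub_sub_sub_cancel_right, dist_eq_norm, NNReal.coe_one]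
    calc |inner ℝ e (x - y)| ≤ ‖e‖ * ‖x - y‖ := abs_real_inner_le_norm _ _
      _ = 1 * ‖x - y‖ := by rw [he]
  -- From each point of the segment, a ray along `v` hits the frontier without changing the
  -- `e`-coordinate. So the 1-Lipschitz projection `g` maps this side of the frontier over `[0, l]`.
  have himg : Set.Icc 0 l ⊆ g '' (frontier K ∩ {x | 0 < inner ℝ v (x - p)}) := by
    rintro s ⟨hs0, hsl⟩
    have hs : p + s • e ∈ interior K := by
      have := hK.interior.add_smul_sub_mem hp hq (t := s / l) ⟨by positivity, by
        rw [div_le_one hl]; exact hsl⟩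
      rwa [add_sub_cancel_left, smul_smul, div_mul_cancel₀ _ hl.ne'] at this
    obtain ⟨t, ht, hmem⟩ := exists_ray_mem_frontier hKb (interior_subset hs) hv
    have ht0 : 0 < t := by
      rcases ht.eq_or_lt with h0 | h0
      · rw [← h0, zero_smul, add_zero] at hmem
        exact absurd hs hmem.2
      · exact h0
    have hsub : p + s • e + t • v - p = s • e + t • v := by abel
    refine ⟨_, ⟨hmem, ?_⟩, ?_⟩
    · change 0 < inner ℝ v (p + s • e + t • v - p)
      rw [hsub, inner_add_right, inner_smul_right, inner_smul_right, real_inner_comm, hev,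
        real_inner_self_eq_norm_sq]
      have := norm_pos_iff.2 hv
      positivity
    · change inner ℝ e (p + s • e + t • v - p) = s
      rw [hsub, inner_add_right, inner_smul_right, inner_smul_right, hev,
        real_inner_self_eq_norm_sq, he]
      ring
  calc ENNReal.ofReal l = Measure.hausdorffMeasure 1 (Set.Icc 0 l) := by
        rw [hausdorffMeasure_real, Real.volume_Icc, sub_zero]
    _ ≤ Measure.hausdorffMeasure 1 (g '' (frontier K ∩ {x | 0 < inner ℝ v (x - p)})) :=
        measure_mono himg
    _ ≤ _ := by simpa using hg.hausdorffMeasure_image_le zero_le_one _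

/-- The graph of a Lipschitz function which is constant outside of `B` is at most slightly longer
than its domain. -/
theorem hausdorffMeasure_graph_le {e v : E} (he : ‖e‖ = 1) (hv : ‖v‖ = 1)
    (hev : inner ℝ e v = 0) {φ : ℝ → ℝ} {κ : NNReal} (hφ : LipschitzWith κ φ) {α β c : ℝ}
    {B : Set ℝ} (hB : MeasurableSet B) (hBs : B ⊆ Set.Icc α β)
    (hc : ∀ s ∈ Set.Icc α β \ B, φ s = c) :
    Measure.hausdorffMeasure 1 ((fun s : ℝ => s • e + φ s • v) '' Set.Icc α β) ≤
      ENNReal.ofReal (β - α) + ENNReal.ofReal (κ ^ 2 / 2) * volume B := by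
  have hnorm : ∀ s t : ℝ, ‖(s • e + φ s • v) - (t • e + φ t • v)‖ ^ 2
      = (s - t) ^ 2 + (φ s - φ t) ^ 2 := by
    intro s t
    have : (s • e + φ s • v) - (t • e + φ t • v) = (s - t) • e + (φ s - φ t) • v := by
      rw [sub_smul, sub_smul]; abel
    rw [this, norm_add_sq_real, norm_smul, norm_smul, he, hv, inner_smul_left, inner_smul_right,
      hev, mul_one, mul_one, Real.norm_eq_abs, Real.norm_eq_abs, sq_abs, sq_abs]
    ring
  -- `√(1 + κ²) ≤ 1 + κ² / 2`.
  have hlipB : LipschitzWith (1 + κ ^ 2 / 2) (fun s : ℝ => s • e + φ s • v) := by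
    refine LipschitzWith.of_dist_le_mul fun s t => ?_
    have h1 := hφ.dist_le_mul s t
    rw [Real.dist_eq, Real.dist_eq] at h1
    rw [dist_eq_norm, Real.dist_eq]
    refine le_of_sq_le_sq ?_ (by positivity)
    rw [hnorm, ← sq_abs (s - t), ← sq_abs (φ s - φ t)]
    have h2 : |φ s - φ t| ^ 2 ≤ (κ * |s - t|) ^ 2 := by gcongr
    push_cast
    nlinarith [mul_nonneg (sq_nonneg ((κ : ℝ) ^ 2)) (sq_nonneg |s - t|)]
  have hlipc : LipschitzOnWith 1 (fun s : ℝ => s • e + φ s • v) (Set.Icc α β \ B) := by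
    refine LipschitzOnWith.of_dist_le_mul fun s hs t ht => ?_
    rw [dist_eq_norm, Real.dist_eq, NNReal.coe_one, one_mul]
    refine le_of_sq_le_sq ?_ (by positivity)
    rw [hnorm, hc s hs, hc t ht, sub_self, sq_abs]
    simp
  have hB1 := hlipB.hausdorffMeasure_image_le zero_le_one B
  have hB2 := hlipc.hausdorffMeasure_image_le zero_le_one
  rw [hausdorffMeasure_real] at hB1 hB2
  rw [ENNReal.rpow_one] at hB1
  rw [ENNReal.rpow_one, ENNReal.coe_one, one_mul] at hB2
  have hκ : ((1 + κ ^ 2 / 2 : NNReal) : ENNReal) = 1 + ENNReal.ofReal (κ ^ 2 / 2) := by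
    rw [ENNReal.coe_add, ENNReal.coe_one]
    congr 1
    rw [ENNReal.ofReal, ENNReal.coe_inj]
    ext
    rw [Real.coe_toNNReal _ (by positivity)]
    push_cast
    rfl
  calc Measure.hausdorffMeasure 1 ((fun s : ℝ => s • e + φ s • v) '' Set.Icc α β)
      ≤ Measure.hausdorffMeasure 1 ((fun s : ℝ => s • e + φ s • v) '' B) +
        Measure.hausdorffMeasure 1 ((fun s : ℝ => s • e + φ s • v) '' (Set.Icc α β \ B)) := by
        refine (measure_mono ?_).trans (measure_union_le _ _)
        rw [← Set.image_union, Set.union_sdiff_cancel hBs]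
    _ ≤ (1 + ENNReal.ofReal (κ ^ 2 / 2)) * volume B + volume (Set.Icc α β \ B) := by
        rw [hκ] at hB1
        exact add_le_add hB1 hB2
    _ = (volume B + volume (Set.Icc α β \ B)) + ENNReal.ofReal (κ ^ 2 / 2) * volume B := by
        ring
    _ = _ := by
        rw [← measure_union Set.disjoint_sdiff_right (measurableSet_Icc.diff hB),
          Set.union_sdiff_cancel hBs, Real.volume_Icc]

end Boundary

/-! ### Perimeter in the plane: chords, degenerate sets, enclosing hexagons. -/

/-- Rotation of the plane by a right angle. -/
def perp (u : Plane) : Plane := !₂[-u 1, u 0]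

theorem inner_perp_self (u : Plane) : inner ℝ u (perp u) = 0 := by
  simp [perp, PiLp.inner_apply, Fin.sum_univ_two]
  ring

theorem norm_perp (u : Plane) : ‖perp u‖ = ‖u‖ := by
  simp [perp, EuclideanSpace.norm_eq, Fin.sum_univ_two, add_comm]

theorem eq_inner_smul_add {u : Plane} (hu : ‖u‖ = 1) (z : Plane) :
    z = (inner ℝ u z : ℝ) • u + (inner ℝ (perp u) z : ℝ) • perp u := by
  have h : u 0 ^ 2 + u 1 ^ 2 = 1 := by
    have := EuclideanSpace.norm_sq_eq u
    simp [hu, Fin.sum_univ_two] at this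
    linarith
  ext i
  fin_cases i
  · simp [perp, PiLp.inner_apply, Fin.sum_univ_two]
    linear_combination (-z 0) * h
  · simp [perp, PiLp.inner_apply, Fin.sum_univ_two]
    linear_combination (-z 1) * h

theorem norm_sq_eq_inner_sq_add {u : Plane} (hu : ‖u‖ = 1) (z : Plane) :
    ‖z‖ ^ 2 = (inner ℝ u z : ℝ) ^ 2 + (inner ℝ (perp u) z : ℝ) ^ 2 := by
  conv_lhs => rw [eq_inner_smul_add hu z]
  rw [norm_add_sq_real, norm_smul, norm_smul, norm_perp, hu, inner_smul_left, inner_smul_right,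
    inner_perp_self, mul_one, mul_one, Real.norm_eq_abs, Real.norm_eq_abs, sq_abs, sq_abs]
  ring

theorem two_mul_edist_le_hausdorffMeasure_frontier_of_mem_interior {K : Set Plane}
    (hK : Convex ℝ K) (hKb : Bornology.IsBounded K) {x y : Plane} (hx : x ∈ interior K)
    (hy : y ∈ interior K) : 2 * edist x y ≤ Measure.hausdorffMeasure 1 (frontier K) := by
  rcases eq_or_ne x y with rfl | hxy
  · simp
  have hl : 0 < ‖y - x‖ := norm_pos_iff.2 (sub_ne_zero.2 hxy.symm)
  obtain ⟨e, he, hye⟩ : ∃ e : Plane, ‖e‖ = 1 ∧ x + ‖y - x‖ • e = y := by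
    refine ⟨‖y - x‖⁻¹ • (y - x), ?_, ?_⟩
    · rw [norm_smul, norm_inv, norm_norm, inv_mul_cancel₀ hl.ne']
    · rw [smul_smul, mul_inv_cancel₀ hl.ne', one_smul, add_sub_cancel]
  have hy' : x + ‖y - x‖ • e ∈ interior K := by rwa [hye]
  have hv : perp e ≠ 0 := by
    rw [← norm_pos_iff, norm_perp, he]
    exact one_pos
  -- The two sides of the chord contribute disjoint pieces of the frontier, each at least as long as
  -- the chord.
  have h1 := ofReal_le_hausdorffMeasure_frontier_inter hK hKb he hv (inner_perp_self e) hx hy'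
  have h2 := ofReal_le_hausdorffMeasure_frontier_inter hK hKb he (neg_ne_zero.2 hv)
    (by rw [inner_neg_right, inner_perp_self, neg_zero]) hx hy'
  have hdist : edist x y = ENNReal.ofReal ‖y - x‖ := by
    rw [edist_comm, edist_dist, dist_eq_norm]
  have hmeas : MeasurableSet (frontier K ∩ {z | 0 < inner ℝ (-perp e) (z - x)}) := by
    refine isClosed_frontier.measurableSet.inter (isOpen_lt ?_ ?_).measurableSet <;> fun_prop
  have hdisj : Disjoint (frontier K ∩ {z | 0 < inner ℝ (perp e) (z - x)})
      (frontier K ∩ {z | 0 < inner ℝ (-perp e) (z - x)}) := by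
    rw [Set.disjoint_left]
    rintro z ⟨-, hz⟩ ⟨-, hz'⟩
    change 0 < inner ℝ (perp e) (z - x) at hz
    change 0 < inner ℝ (-perp e) (z - x) at hz'
    rw [inner_neg_left] at hz'
    linarith
  rw [hdist, two_mul]
  refine (add_le_add h1 h2).trans ?_
  rw [← measure_union hdisj hmeas]
  exact measure_mono (Set.union_subset Set.inter_subset_left Set.inter_subset_left)

/-- The boundary of a planar convex body is at least twice as long as any chord. -/
theorem two_mul_edist_le_hausdorffMeasure_frontier {K : Set Plane} (hK : Convex ℝ K)
    (hKb : Bornology.IsBounded K) (hint : (interior K).Nonempty) {p q : Plane} (hp : p ∈ K)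
    (hq : q ∈ K) : 2 * edist p q ≤ Measure.hausdorffMeasure 1 (frontier K) := by
  have hcl : ∀ x ∈ closure (interior K), ∀ y ∈ closure (interior K),
      2 * edist x y ≤ Measure.hausdorffMeasure 1 (frontier K) := by
    intro x hx y hy
    refine closure_minimal (t := {w | 2 * edist w y ≤ Measure.hausdorffMeasure 1 (frontier K)})
      (fun w hw => ?_) (isClosed_le ?_ continuous_const) hx
    · refine closure_minimal (t := {z | 2 * edist w z ≤ Measure.hausdorffMeasure 1 (frontier K)})
        (fun z hz => ?_) (isClosed_le ?_ continuous_const) hy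
      · exact two_mul_edist_le_hausdorffMeasure_frontier_of_mem_interior hK hKb hw hz
      · exact (ENNReal.continuous_const_mul ENNReal.ofNat_ne_top).comp
          (continuous_const.edist continuous_id)
    · exact (ENNReal.continuous_const_mul ENNReal.ofNat_ne_top).comp
        (continuous_id.edist continuous_const)
  rw [hK.closure_interior_eq_closure_of_nonempty_interior hint] at hcl
  exact hcl p (subset_closure hp) q (subset_closure hq)

/-- The length of a planar convex set without interior points is its diameter. -/
theorem hausdorffMeasure_eq_ediam_of_interior_eq_empty {K : Set Plane} (hK : Convex ℝ K)
    (hint : interior K = ∅) : Measure.hausdorffMeasure 1 K = Metric.ediam K := by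
  apply le_antisymm
  · rcases K.eq_empty_or_nonempty with rfl | ⟨p, hp⟩
    · simp
    have hspan : vectorSpan ℝ K ≠ ⊤ := by
      intro h
      rw [← AffineSubspace.affineSpan_eq_top_iff_vectorSpan_eq_top_of_nonempty ℝ Plane Plane
        ⟨p, hp⟩, ← hK.interior_nonempty_iff_affineSpan_eq_top, hint] at h
      exact Set.not_nonempty_empty h
    -- Without interior points, `K` spans a proper direction space; a unit normal `u` to it places
    -- `K` on the line `p + ℝ • perp u`, which is isometric to `ℝ`.
    have horth : (vectorSpan ℝ K)ᗮ ≠ ⊥ := by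
      rwa [Ne, Submodule.orthogonal_eq_bot_iff]
    obtain ⟨v, hv, hv0⟩ := Submodule.exists_mem_ne_zero_of_ne_bot horth
    have hl : 0 < ‖v‖ := norm_pos_iff.2 hv0
    set u : Plane := ‖v‖⁻¹ • v
    have hu : ‖u‖ = 1 := by rw [norm_smul, norm_inv, norm_norm, inv_mul_cancel₀ hl.ne']
    have hux : ∀ x ∈ K, inner ℝ u (x - p) = 0 := by
      intro x hx
      have h := (Submodule.mem_orthogonal _ _).1 hv _ (vsub_mem_vectorSpan ℝ hx hp)
      rw [vsub_eq_sub] at h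
      rw [inner_smul_left, real_inner_comm, h, mul_zero]
    have hiso : Isometry fun s : ℝ => p + s • perp u := by
      refine Isometry.of_dist_eq fun s t => ?_
      rw [dist_add_left, dist_eq_norm, ← sub_smul, norm_smul, norm_perp, hu, mul_one, Real.dist_eq,
        Real.norm_eq_abs]
    have hcov : K ⊆ (fun s : ℝ => p + s • perp u) '' ((fun s : ℝ => p + s • perp u) ⁻¹' K) := by
      intro x hx
      have h := eq_inner_smul_add hu (x - p)
      rw [hux x hx, zero_smul, zero_add] at h
      have h' : p + (inner ℝ (perp u) (x - p) : ℝ) • perp u = x := by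
        rw [← h, add_sub_cancel]
      exact ⟨inner ℝ (perp u) (x - p), by rw [Set.mem_preimage, h']; exact hx, h'⟩
    calc Measure.hausdorffMeasure 1 K
        ≤ Measure.hausdorffMeasure 1
          ((fun s : ℝ => p + s • perp u) '' ((fun s : ℝ => p + s • perp u) ⁻¹' K)) :=
          measure_mono hcov
      _ = volume ((fun s : ℝ => p + s • perp u) ⁻¹' K) := by
          rw [hiso.hausdorffMeasure_image (Or.inl zero_le_one), hausdorffMeasure_real]
      _ ≤ Metric.ediam ((fun s : ℝ => p + s • perp u) ⁻¹' K) := Real.volume_le_diam _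
      _ = Metric.ediam ((fun s : ℝ => p + s • perp u) '' ((fun s : ℝ => p + s • perp u) ⁻¹' K)) :=
          (hiso.ediam_image _).symm
      _ ≤ Metric.ediam K := Metric.ediam_mono (Set.image_preimage_subset _ _)
  · refine Metric.ediam_le fun x hx y hy => ?_
    rw [← hausdorffMeasure_segment]
    exact measure_mono (hK.segment_subset hx hy)

/-- Upper boundary of a hexagonal region of height at most `M` around the segment from `(-a, 0)`
to `(b, Y)`, with sides of slope `±δ`. -/
def hexTop (M a b δ Y s : ℝ) : ℝ := min M (min (δ * (s + a)) (Y + δ * (b - s)))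

theorem lipschitzWith_hexTop (M a b Y : ℝ) (δ : NNReal) :
    LipschitzWith δ (hexTop M a b δ Y) := by
  have h1 : LipschitzWith δ fun s : ℝ => (δ : ℝ) * (s + a) :=
    LipschitzWith.of_dist_le_mul fun s t => by
      rw [Real.dist_eq, Real.dist_eq, ← mul_sub, abs_mul, NNReal.abs_eq,
        add_sub_add_right_eq_sub]
  have h2 : LipschitzWith δ fun s : ℝ => Y + (δ : ℝ) * (b - s) :=
    LipschitzWith.of_dist_le_mul fun s t => by
      rw [Real.dist_eq, Real.dist_eq, add_sub_add_left_eq_sub, ← mul_sub, abs_mul,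
        NNReal.abs_eq, sub_sub_sub_cancel_left, abs_sub_comm]
  have := (h1.min h2).const_min M
  rwa [max_self] at this

theorem hausdorffMeasure_graph_hexTop_le {e v : Plane} (he : ‖e‖ = 1) (hv : ‖v‖ = 1)
    (hev : inner ℝ e v = 0) {M a b δ Y : ℝ} (hδ : 0 < δ) (hY : |Y| ≤ M) :
    Measure.hausdorffMeasure 1
      ((fun s : ℝ => s • e + hexTop M a b δ Y s • v) '' Set.Icc (-a) b) ≤
      ENNReal.ofReal (a + b) + ENNReal.ofReal (3 / 2 * δ * M) := by
  have hM : 0 ≤ M := (abs_nonneg Y).trans hY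
  lift δ to NNReal using hδ.le
  -- `B` contains both ramps. The left one climbs from `0` to `M`; the right one climbs from `Y ≥
  -- -M`, hence at most `2 * M`. The total width `3 * M / δ` times `δ² / 2` gives the error `3 / 2 *
  -- δ * M`.
  set B : Set ℝ := Set.Icc (-a) b ∩ (Set.Ico (-a) (-a + M / δ) ∪ Set.Ioc (b - 2 * M / δ) b)
  have hB : MeasurableSet B :=
    measurableSet_Icc.inter (measurableSet_Ico.union measurableSet_Ioc)
  have hc : ∀ s ∈ Set.Icc (-a) b \ B, hexTop M a b δ Y s = M := by
    rintro s ⟨hs, hsB⟩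
    have h1 : -a + M / δ ≤ s := by
      by_contra! h
      exact hsB ⟨hs, Or.inl ⟨hs.1, h⟩⟩
    have h2 : s ≤ b - 2 * M / δ := by
      by_contra! h
      exact hsB ⟨hs, Or.inr ⟨h, hs.2⟩⟩
    have h3 : M ≤ δ * (s + a) := by
      rw [← div_le_iff₀' hδ]; linarith
    have h4 : 2 * M ≤ δ * (b - s) := by
      rw [← div_le_iff₀' hδ]; linarith
    have h5 := neg_abs_le Y
    exact min_eq_left (le_min h3 (by linarith))
  have hvol : volume B ≤ ENNReal.ofReal (3 * M / δ) := by
    calc volume B ≤ volume (Set.Ico (-a) (-a + M / δ)) + volume (Set.Ioc (b - 2 * M / δ) b) :=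
          (measure_mono Set.inter_subset_right).trans (measure_union_le _ _)
      _ = ENNReal.ofReal (3 * M / δ) := by
          rw [Real.volume_Ico, Real.volume_Ioc, ← ENNReal.ofReal_add]
          · congr 1
            ring
          · rw [add_sub_cancel_left]; positivity
          · rw [sub_sub_cancel]; positivity
  refine (hausdorffMeasure_graph_le he hv hev (lipschitzWith_hexTop M a b Y δ) hB
    Set.inter_subset_left hc).trans ?_
  refine add_le_add (le_of_eq (by congr 1; ring)) ?_
  calc ENNReal.ofReal (δ ^ 2 / 2) * volume B
      ≤ ENNReal.ofReal (δ ^ 2 / 2) * ENNReal.ofReal (3 * M / δ) := by gcongr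
    _ = ENNReal.ofReal (3 / 2 * δ * M) := by
      rw [← ENNReal.ofReal_mul (by positivity)]
      congr 1
      field_simp

/-- Upper bound for the boundary length of a convex body contained in a hexagonal region. -/
theorem hausdorffMeasure_frontier_le_of_hexagon {K : Set Plane} (hK : Convex ℝ K)
    (hKc : IsClosed K) (hint : (interior K).Nonempty) {u : Plane} (hu : ‖u‖ = 1)
    {M a b δ Y : ℝ} (hδ : 0 < δ) (hY : |Y| ≤ M) (h1 : ∀ z ∈ K, |inner ℝ (perp u) z| ≤ M)
    (h2 : ∀ z ∈ K, |inner ℝ (perp u) z| ≤ δ * (inner ℝ u z + a))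
    (h3 : ∀ z ∈ K, |inner ℝ (perp u) z - Y| ≤ δ * (b - inner ℝ u z)) :
    Measure.hausdorffMeasure 1 (frontier K) ≤ ENNReal.ofReal (2 * (a + b) + 3 * δ * M) := by
  have hM : 0 ≤ M := (abs_nonneg Y).trans hY
  set Q : Set Plane := {z | |inner ℝ (perp u) z| ≤ M ∧
    |inner ℝ (perp u) z| ≤ δ * (inner ℝ u z + a) ∧
    |inner ℝ (perp u) z - Y| ≤ δ * (b - inner ℝ u z)}
  have hKQ : K ⊆ Q := fun z hz => ⟨h1 z hz, h2 z hz, h3 z hz⟩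
  have hIcc : ∀ z ∈ Q, inner ℝ u z ∈ Set.Icc (-a) b := by
    rintro z ⟨-, hz2, hz3⟩
    have e1 := nonneg_of_mul_nonneg_right ((abs_nonneg _).trans hz2) hδ
    have e2 := nonneg_of_mul_nonneg_right ((abs_nonneg _).trans hz3) hδ
    exact ⟨by linarith, by linarith⟩
  have hab : 0 ≤ a + b := by
    obtain ⟨z, hz⟩ := hint
    have := hIcc z (hKQ (interior_subset hz))
    linarith [this.1, this.2]
  have hQb : Bornology.IsBounded Q := by
    refine isBounded_iff_forall_norm_le.2 ⟨|a| + |b| + M, fun z hz => ?_⟩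
    have h := hIcc z hz
    rw [eq_inner_smul_add hu z]
    refine (norm_add_le _ _).trans (add_le_add ?_ ?_)
    · rw [norm_smul, hu, mul_one, Real.norm_eq_abs, abs_le]
      constructor
      · linarith [h.1, le_abs_self a, abs_nonneg b]
      · linarith [h.2, le_abs_self b, abs_nonneg a]
    · rw [norm_smul, norm_perp, hu, mul_one, Real.norm_eq_abs]
      exact hz.1
  have hQc : IsClosed Q := by
    simp only [Q, Set.ofPred_and]
    refine (isClosed_le ?_ ?_).inter ((isClosed_le ?_ ?_).inter (isClosed_le ?_ ?_)) <;> fun_prop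
  -- A point of `Q` strictly between the upper and lower graphs is interior. The lower graph is an
  -- upper graph for `-Y` in the direction `-perp u`.
  have hfr : frontier Q ⊆
      ((fun s : ℝ => s • u + hexTop M a b δ Y s • perp u) '' Set.Icc (-a) b) ∪
      ((fun s : ℝ => s • u + hexTop M a b δ (-Y) s • -perp u) '' Set.Icc (-a) b) := by
    intro z hz
    have hzQ := hQc.frontier_subset hz
    have hzI := hIcc z hzQ
    obtain ⟨hz1, hz2, hz3⟩ := hzQ
    set x : ℝ := inner ℝ u z
    set y : ℝ := inner ℝ (perp u) z
    have hzxy : z = x • u + y • perp u := eq_inner_smul_add hu z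
    rw [abs_le] at hz1 hz2 hz3
    have htop : y ≤ hexTop M a b δ Y x := le_min hz1.2 (le_min hz2.2 (by linarith [hz3.2]))
    have hbot : -y ≤ hexTop M a b δ (-Y) x :=
      le_min (by linarith [hz1.1]) (le_min (by linarith [hz2.1]) (by linarith [hz3.1]))
    rcases htop.eq_or_lt with h | h
    · exact Or.inl ⟨x, hzI, by rw [hzxy]; simp only [h]⟩
    rcases hbot.eq_or_lt with h' | h'
    · refine Or.inr ⟨x, hzI, ?_⟩
      rw [hzxy]
      simp only [← h', smul_neg, neg_smul, neg_neg]
    exfalso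
    apply hz.2
    rw [hexTop, lt_min_iff, lt_min_iff] at h h'
    refine mem_interior.2 ⟨{w : Plane | |inner ℝ (perp u) w| < M ∧
      |inner ℝ (perp u) w| < δ * (inner ℝ u w + a) ∧
      |inner ℝ (perp u) w - Y| < δ * (b - inner ℝ u w)}, ?_, ?_, ?_⟩
    · exact fun w hw => ⟨hw.1.le, hw.2.1.le, hw.2.2.le⟩
    · simp only [Set.ofPred_and]
      refine (isOpen_lt ?_ ?_).inter ((isOpen_lt ?_ ?_).inter (isOpen_lt ?_ ?_)) <;> fun_prop
    · refine ⟨abs_lt.2 ⟨?_, ?_⟩, abs_lt.2 ⟨?_, ?_⟩, abs_lt.2 ⟨?_, ?_⟩⟩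
      · change -M < y; linarith
      · change y < M; linarith
      · change -(δ * (x + a)) < y; linarith
      · change y < δ * (x + a); linarith
      · change -(δ * (b - x)) < y - Y; linarith
      · change y - Y < δ * (b - x); linarith
  have g1 := hausdorffMeasure_graph_hexTop_le (a := a) (b := b) hu ((norm_perp u).trans hu)
    (inner_perp_self u) hδ hY
  have g2 := hausdorffMeasure_graph_hexTop_le (M := M) (a := a) (b := b) (Y := -Y) hu
    (v := -perp u) (by rw [norm_neg, norm_perp, hu])
    (by rw [inner_neg_right, inner_perp_self, neg_zero]) hδ (by rwa [abs_neg])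
  calc Measure.hausdorffMeasure 1 (frontier K)
      ≤ Measure.hausdorffMeasure 1 (frontier Q) :=
        hausdorffMeasure_frontier_mono zero_le_one hK hKc hint hKQ hQb
    _ ≤ _ := (measure_mono hfr).trans ((measure_union_le _ _).trans (add_le_add g1 g2))
    _ = ENNReal.ofReal (2 * (a + b) + 3 * δ * M) := by
      have hδM : 0 ≤ 3 / 2 * δ * M := by positivity
      rw [← ENNReal.ofReal_add hab hδM, ← ENNReal.ofReal_add (add_nonneg hab hδM)
        (add_nonneg hab hδM)]
      congr 1
      ring

theorem hausdorffMeasure_frontier_ne_top {K : Set Plane} (hK : Convex ℝ K) (hKc : IsClosed K)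
    (hKb : Bornology.IsBounded K) (hint : (interior K).Nonempty) :
    Measure.hausdorffMeasure 1 (frontier K) ≠ ⊤ := by
  obtain ⟨R, hR⟩ := hKb.exists_norm_le
  set u : Plane := EuclideanSpace.single 0 1
  have hu : ‖u‖ = 1 := by simp [u]
  have hinner : ∀ w : Plane, ‖w‖ = 1 → ∀ z ∈ K, |inner ℝ w z| ≤ R := fun w hw z hz => by
    refine (abs_real_inner_le_norm w z).trans ?_
    rw [hw, one_mul]
    exact hR z hz
  have hR0 : 0 ≤ R := by
    obtain ⟨z, hz⟩ := hint
    exact (norm_nonneg z).trans (hR z (interior_subset hz))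
  have h1 := hinner u hu
  have h2 := hinner (perp u) ((norm_perp u).trans hu)
  refine ne_top_of_le_ne_top ENNReal.ofReal_ne_top (hausdorffMeasure_frontier_le_of_hexagon hK hKc
    hint hu (M := R) (a := 2 * R) (b := 2 * R) (δ := 1) (Y := 0) one_pos (by simpa using hR0) h2
    (fun z hz => ?_) (fun z hz => ?_))
  · have := h2 z hz
    have := abs_le.1 (h1 z hz)
    linarith
  · have := h2 z hz
    have := abs_le.1 (h1 z hz)
    rw [sub_zero]
    linarith

theorem perimeter_of_interior_eq_empty {K : Set Plane} (hK : Convex ℝ K) (hint : interior K = ∅) :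
    perimeter K = 2 * Metric.diam K := by
  rw [perimeter, if_neg (by simp [hint]), hausdorffMeasure_eq_ediam_of_interior_eq_empty hK hint,
    Metric.diam]

theorem two_mul_dist_le_perimeter {K : Set Plane} (hK : Convex ℝ K) (hKc : IsClosed K)
    (hKb : Bornology.IsBounded K) {p q : Plane} (hp : p ∈ K) (hq : q ∈ K) :
    2 * dist p q ≤ perimeter K := by
  rcases (interior K).eq_empty_or_nonempty with hint | hint
  · rw [perimeter_of_interior_eq_empty hK hint]
    have := Metric.dist_le_diam_of_mem hKb hp hq
    linarith
  · rw [perimeter, if_pos hint]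
    have h := ENNReal.toReal_mono (hausdorffMeasure_frontier_ne_top hK hKc hKb hint)
      (two_mul_edist_le_hausdorffMeasure_frontier hK hKb hint hp hq)
    rwa [ENNReal.toReal_mul, ENNReal.toReal_ofNat, ← dist_edist] at h

theorem perimeter_le_of_hexagon {K : Set Plane} (hK : Convex ℝ K) (hKc : IsClosed K)
    (hne : K.Nonempty) {u : Plane} (hu : ‖u‖ = 1) {M a b δ Y : ℝ} (hδ : 0 < δ)
    (hY : |Y| ≤ M) (h1 : ∀ z ∈ K, |inner ℝ (perp u) z| ≤ M)
    (h2 : ∀ z ∈ K, |inner ℝ (perp u) z| ≤ δ * (inner ℝ u z + a))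
    (h3 : ∀ z ∈ K, |inner ℝ (perp u) z - Y| ≤ δ * (b - inner ℝ u z)) :
    perimeter K ≤ 2 * (a + b) + 3 * δ * M := by
  have hM : 0 ≤ M := (abs_nonneg Y).trans hY
  have hab : 0 ≤ a + b := by
    obtain ⟨z, hz⟩ := hne
    have e1 := nonneg_of_mul_nonneg_right ((abs_nonneg _).trans (h2 z hz)) hδ
    have e2 := nonneg_of_mul_nonneg_right ((abs_nonneg _).trans (h3 z hz)) hδ
    linarith
  rcases (interior K).eq_empty_or_nonempty with hint | hint
  · rw [perimeter_of_interior_eq_empty hK hint]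
    -- The transversal difference is at most both `2 * M` and `δ * (a + b)`, so a squared distance
    -- is at most `(a + b)² + 2 * M * δ * (a + b) ≤ (a + b + δ * M)²`.
    have hdiam : Metric.diam K ≤ a + b + δ * M := by
      refine Metric.diam_le_of_forall_dist_le (by positivity) fun z hz w hw => ?_
      have z1 := abs_le.1 (h1 z hz)
      have z2 := abs_le.1 (h2 z hz)
      have z3 := abs_le.1 (h3 z hz)
      have w1 := abs_le.1 (h1 w hw)
      have w2 := abs_le.1 (h2 w hw)
      have w3 := abs_le.1 (h3 w hw)
      rw [dist_eq_norm]
      refine le_of_sq_le_sq ?_ (by positivity)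
      rw [norm_sq_eq_inner_sq_add hu, inner_sub_right, inner_sub_right]
      have hx : |(inner ℝ u z - inner ℝ u w : ℝ)| ≤ a + b := by
        have e1 := nonneg_of_mul_nonneg_right ((abs_nonneg _).trans (h2 z hz)) hδ
        have e2 := nonneg_of_mul_nonneg_right ((abs_nonneg _).trans (h3 z hz)) hδ
        have e3 := nonneg_of_mul_nonneg_right ((abs_nonneg _).trans (h2 w hw)) hδ
        have e4 := nonneg_of_mul_nonneg_right ((abs_nonneg _).trans (h3 w hw)) hδ
        rw [abs_le]
        constructor <;> linarith
      have hy : |(inner ℝ (perp u) z - inner ℝ (perp u) w : ℝ)| ≤ 2 * M := by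
        rw [abs_le]
        constructor <;> linarith
      have hy' : |(inner ℝ (perp u) z - inner ℝ (perp u) w : ℝ)| ≤ δ * (a + b) := by
        rw [abs_le]
        constructor <;> linarith
      have hx2 := pow_le_pow_left₀ (abs_nonneg _) hx 2
      have hy2 := mul_le_mul hy hy' (abs_nonneg _) (by positivity)
      rw [sq_abs] at hx2
      rw [abs_mul_abs_self] at hy2
      nlinarith [sq_nonneg (δ * M)]
    have : 0 ≤ δ * M := by positivity
    linarith
  · rw [perimeter, if_pos hint]
    exact ENNReal.toReal_le_of_le_ofReal (by positivity)
      (hausdorffMeasure_frontier_le_of_hexagon hK hKc hint hu hδ hY h1 h2 h3)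

/-! ### Measurability of the perimeter of a hull. -/

theorem exists_smul_subset_convexHull_of_dist_lt {E ι : Type*} [NormedAddCommGroup E]
    [InnerProductSpace ℝ E] [FiniteDimensional ℝ E] [Finite ι] {x : ι → E} {c : E} {ρ l : ℝ}
    (hρ : 0 < ρ) (hball : Metric.ball c ρ ⊆ convexHull ℝ (Set.range x)) (hl0 : 0 < l)
    (hl1 : l < 1) : ∃ r > 0, ∀ x' : ι → E, (∀ i, dist (x' i) (x i) < r) →
      ∀ z ∈ convexHull ℝ (Set.range x), Metric.ball (c + l • (z - c)) r ⊆
        convexHull ℝ (Set.range x') := by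
  -- By convexity the hull contains the ball of radius `(1 - l) * ρ` around the contracted point;
  -- half of this radius is given up to the perturbation of the vertices.
  refine ⟨(1 - l) * ρ / 2, by nlinarith, fun x' hx' z hz => ?_⟩
  refine ball_subset_convexHull_of_dist_lt (by nlinarith) ?_ hx'
  intro w hw
  rw [Metric.mem_ball, dist_eq_norm] at hw
  have hl1' : 0 < 1 - l := by linarith
  have hmem : c + (1 - l)⁻¹ • (w - (c + l • (z - c))) ∈ Metric.ball c ρ := by
    rw [Metric.mem_ball, dist_eq_norm, add_sub_cancel_left, norm_smul, norm_inv,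
      Real.norm_of_nonneg hl1'.le, inv_mul_lt_iff₀ hl1']
    linarith
  have := convex_convexHull ℝ (Set.range x) hz (hball hmem) hl0.le hl1'.le (by ring)
  rw [smul_add, smul_smul, mul_inv_cancel₀ hl1'.ne', one_smul] at this
  convert this using 1
  module

/-- On the open set `U` of configurations whose hull has interior points, the perimeter is lower
semicontinuous: a hull contracted by `l < 1` fits into all nearby hulls, and perimeter is monotone.
Off `U` it is twice the diameter of the vertices. -/
theorem measurable_perimeter_convexHull (ι : Type*) [Finite ι] :
    Measurable fun x : ι → Plane => perimeter (convexHull ℝ (Set.range x)) := by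
  have hfin := Fintype.ofFinite ι
  set F : (ι → Plane) → ℝ := fun x => perimeter (convexHull ℝ (Set.range x))
  set U : Set (ι → Plane) := {x | (interior (convexHull ℝ (Set.range x))).Nonempty}
  have hcl : ∀ x : ι → Plane, IsClosed (convexHull ℝ (Set.range x)) := fun x =>
    (Set.finite_range x).isClosed_convexHull ℝ
  have hbd : ∀ x : ι → Plane, Bornology.IsBounded (convexHull ℝ (Set.range x)) := fun x =>
    ((Set.finite_range x).isCompact_convexHull ℝ).isBounded
  have hball : ∀ x ∈ U, ∃ c, ∃ ρ > 0, Metric.ball c ρ ⊆ convexHull ℝ (Set.range x) := by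
    rintro x ⟨c, hc⟩
    obtain ⟨ρ, hρ, h⟩ := Metric.isOpen_iff.1 isOpen_interior c hc
    exact ⟨c, ρ, hρ, h.trans interior_subset⟩
  have hopen : ∀ t : ℝ, IsOpen (U ∩ {x | t < F x}) := by
    intro t
    rw [Metric.isOpen_iff]
    rintro x ⟨hxU, hxt⟩
    obtain ⟨c, ρ, hρ, hcρ⟩ := hball x hxU
    obtain ⟨l, hl0, hl1, hlt⟩ : ∃ l : ℝ, 0 < l ∧ l < 1 ∧ t < l * F x := by
      have h1 : Tendsto (fun l : ℝ => l * F x) (𝓝[<] 1) (𝓝 (1 * F x)) :=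
        ((continuous_id.mul continuous_const).tendsto 1).mono_left nhdsWithin_le_nhds
      rw [one_mul] at h1
      have h2 := h1.eventually (lt_mem_nhds hxt)
      have h3 : ∀ᶠ l : ℝ in 𝓝[<] 1, l ∈ Set.Ioo 0 1 := Ioo_mem_nhdsLT one_pos
      obtain ⟨l, hl, hl'⟩ := (h2.and h3).exists
      exact ⟨l, hl'.1, hl'.2, hl⟩
    obtain ⟨r, hr, hsub⟩ := exists_smul_subset_convexHull_of_dist_lt hρ hcρ hl0 hl1
    refine ⟨r, hr, fun x' hx' => ?_⟩
    have hx'' : ∀ i, dist (x' i) (x i) < r := fun i =>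
      (dist_le_pi_dist x' x i).trans_lt hx'
    have hx'U : x' ∈ U := by
      have hcc := hsub x' hx'' c (hcρ (Metric.mem_ball_self hρ))
      rw [sub_self, smul_zero, add_zero] at hcc
      exact ⟨c, mem_interior.2 ⟨_, hcc, Metric.isOpen_ball, Metric.mem_ball_self hr⟩⟩
    refine ⟨hx'U, hlt.trans_le ?_⟩
    set K := convexHull ℝ (Set.range x)
    set K' := convexHull ℝ (Set.range x')
    let e : Plane ≃ₜ Plane :=
      (Homeomorph.smulOfNeZero l hl0.ne').trans (Homeomorph.addLeft (c - l • c))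
    have he : ∀ z, e z = c + l • (z - c) := fun z => by
      change c - l • c + l • z = _
      module
    have hehom : ⇑e = AffineMap.homothety c l := by
      ext1 z
      rw [he, AffineMap.homothety_apply, vsub_eq_sub, vadd_eq_add, add_comm]
    have hconv : Convex ℝ (e '' K) := by
      rw [hehom]
      exact (convex_convexHull ℝ _).affine_image _
    have h := hausdorffMeasure_frontier_mono zero_le_one hconv (e.isClosed_image.2 (hcl x))
      (by rw [← e.image_interior]; exact hxU.image _) (Q := K') (by
        rintro _ ⟨z, hz, rfl⟩
        rw [he]
        exact hsub x' hx'' z hz (Metric.mem_ball_self hr)) (hbd x')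
    rw [← e.image_frontier, hehom, hausdorffMeasure_homothety_image zero_le_one c hl0.ne',
      NNReal.rpow_one] at h
    have h' := ENNReal.toReal_mono
      (hausdorffMeasure_frontier_ne_top (convex_convexHull ℝ _) (hcl x') (hbd x') hx'U) h
    rw [ENNReal.smul_def, smul_eq_mul, ENNReal.toReal_mul, ENNReal.coe_toReal, coe_nnnorm,
      Real.norm_of_nonneg hl0.le] at h'
    change l * perimeter K ≤ perimeter K'
    have hxU' : (interior K).Nonempty := hxU
    have hx'U' : (interior K').Nonempty := hx'U
    rw [perimeter, perimeter, if_pos hxU', if_pos hx'U']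
    exact h'
  have hU : IsOpen U := by
    -- Openness of `U` comes for free from `hopen`, since `F` is real-valued.
    have : U = ⋃ n : ℕ, U ∩ {x | -(n : ℝ) < F x} := by
      rw [← Set.inter_iUnion, eq_comm, Set.inter_eq_left]
      intro x _
      obtain ⟨n, hn⟩ := exists_nat_gt (-F x)
      exact Set.mem_iUnion.2 ⟨n, by change -(n : ℝ) < F x; linarith⟩
    rw [this]
    exact isOpen_iUnion fun n => hopen _
  have hdiam : Measurable fun x : ι → Plane => 2 * Metric.diam (Set.range x) := by
    have h1 : ∀ x : ι → Plane, Metric.ediam (Set.range x) = ⨆ i, ⨆ j, edist (x i) (x j) := by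
      intro x
      simp only [Metric.ediam, iSup_range]
    have h2 : Measurable fun x : ι → Plane => Metric.ediam (Set.range x) := by
      simp only [h1]
      exact Measurable.iSup fun i => Measurable.iSup fun j =>
        (measurable_pi_apply i).edist (measurable_pi_apply j)
    exact measurable_const.mul h2.ennreal_toReal
  refine measurable_of_Ioi fun t => ?_
  have hset : F ⁻¹' Set.Ioi t = (U ∩ {x | t < F x}) ∪
      (Uᶜ ∩ {x | t < 2 * Metric.diam (Set.range x)}) := by
    have hF : ∀ x ∈ Uᶜ, F x = 2 * Metric.diam (Set.range x) := fun x hx => by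
      rw [← convexHull_diam]
      exact perimeter_of_interior_eq_empty (convex_convexHull ℝ _) (Set.not_nonempty_iff_eq_empty.1 hx)
    ext x
    by_cases hx : x ∈ U
    · simp [hx]
    · simp [hx, hF x hx]
  rw [hset]
  exact (hopen t).measurableSet.union (hU.measurableSet.compl.inter
    (measurableSet_lt measurable_const hdiam))

/-- All hexagon constraints have this form, so they need checking only at the positions of the walk.
-/
theorem convex_setOf_abs_inner_sub_le {E : Type*} [NormedAddCommGroup E] [InnerProductSpace ℝ E]
    (v w : E) (Y d : ℝ) : Convex ℝ {z : E | |inner ℝ v z - Y| ≤ inner ℝ w z + d} := by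
  intro x hx y hy s t hs ht hst
  change |inner ℝ v x - Y| ≤ inner ℝ w x + d at hx
  change |inner ℝ v y - Y| ≤ inner ℝ w y + d at hy
  change |inner ℝ v (s • x + t • y) - Y| ≤ inner ℝ w (s • x + t • y) + d
  rw [abs_le] at *
  simp only [inner_add_right, inner_smul_right]
  have h : t = 1 - s := by linarith
  subst h
  constructor
  · nlinarith [mul_le_mul_of_nonneg_left hx.1 hs, mul_le_mul_of_nonneg_left hy.1 ht]
  · nlinarith [mul_le_mul_of_nonneg_left hx.2 hs, mul_le_mul_of_nonneg_left hy.2 ht]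

/-! ### Perimeter bounds for the hull of a walk. -/

section Walk

variable {Ω : Type*} (Z : ℕ → Ω → Plane) (n : ℕ) (ω : Ω)

theorem walkHull_eq_convexHull_range :
    walkHull Z n ω = convexHull ℝ (Set.range fun j : Fin (n + 1) => walk Z j ω) := by
  rw [walkHull]
  congr 1
  ext z
  simp only [Set.mem_image, Set.mem_Iic, Set.mem_range]
  constructor
  · rintro ⟨j, hj, rfl⟩
    exact ⟨⟨j, by omega⟩, rfl⟩
  · rintro ⟨j, rfl⟩
    exact ⟨j, by omega, rfl⟩

theorem convex_walkHull : Convex ℝ (walkHull Z n ω) := convex_convexHull ℝ _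

theorem isCompact_walkHull : IsCompact (walkHull Z n ω) :=
  Set.Finite.isCompact_convexHull ℝ ((Set.finite_Iic n).image fun j => walk Z j ω)

theorem walk_mem_walkHull {j : ℕ} (hj : j ≤ n) : walk Z j ω ∈ walkHull Z n ω :=
  subset_convexHull ℝ _ ⟨j, hj, rfl⟩

theorem measurable_hullPerimeter [MeasurableSpace Ω] (hZ : ∀ i, Measurable (Z i)) :
    Measurable (hullPerimeter Z n) := by
  have h : Measurable fun ω => fun j : Fin (n + 1) => walk Z j ω :=
    measurable_pi_lambda _ fun j => Finset.measurable_fun_sum _ fun i _ => hZ i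
  have := (measurable_perimeter_convexHull (Fin (n + 1))).comp h
  convert this using 1
  ext1 ω
  rw [hullPerimeter, walkHull_eq_convexHull_range]
  rfl

theorem two_mul_norm_walk_le_hullPerimeter : 2 * ‖walk Z n ω‖ ≤ hullPerimeter Z n ω := by
  have h := two_mul_dist_le_perimeter (convex_walkHull Z n ω) (isCompact_walkHull Z n ω).isClosed
    (isCompact_walkHull Z n ω).isBounded (walk_mem_walkHull Z n ω le_rfl)
    (walk_mem_walkHull Z n ω (Nat.zero_le n))
  have h0 : walk Z 0 ω = 0 := Finset.sum_range_zero _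
  rwa [h0, dist_zero_right] at h

theorem hullPerimeter_le {u : Plane} (hu : ‖u‖ = 1) {M a b δ : ℝ} (hδ : 0 < δ)
    (h1 : ∀ j ≤ n, |inner ℝ (perp u) (walk Z j ω)| ≤ M)
    (h2 : ∀ j ≤ n, |inner ℝ (perp u) (walk Z j ω)| ≤ δ * (inner ℝ u (walk Z j ω) + a))
    (h3 : ∀ j ≤ n, |inner ℝ (perp u) (walk Z j ω) - inner ℝ (perp u) (walk Z n ω)| ≤
      δ * (b - inner ℝ u (walk Z j ω))) :
    hullPerimeter Z n ω ≤ 2 * (a + b) + 3 * δ * M := by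
  have key : ∀ (w : Plane) (Y d : ℝ),
      (∀ j ≤ n, |inner ℝ (perp u) (walk Z j ω) - Y| ≤ inner ℝ w (walk Z j ω) + d) →
      ∀ z ∈ walkHull Z n ω, |inner ℝ (perp u) z - Y| ≤ inner ℝ w z + d := by
    intro w Y d h
    refine convexHull_min ?_ (convex_setOf_abs_inner_sub_le (perp u) w Y d)
    rintro _ ⟨j, hj, rfl⟩
    exact h j hj
  refine perimeter_le_of_hexagon (convex_walkHull Z n ω) (isCompact_walkHull Z n ω).isClosed
    ⟨_, walk_mem_walkHull Z n ω le_rfl⟩ hu hδ (h1 n le_rfl) ?_ ?_ ?_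
  · simpa using key 0 0 M (by simpa using h1)
  · have := key (δ • u) 0 (δ * a) (fun j hj => by
      simpa [inner_smul_left, mul_add] using h2 j hj)
    simpa [inner_smul_left, mul_add] using this
  · have := key (-δ • u) (inner ℝ (perp u) (walk Z n ω)) (δ * b) (fun j hj => by
      have := h3 j hj
      rw [inner_smul_left]
      simp only [conj_trivial]
      linarith)
    intro z hz
    have := this z hz
    rw [inner_smul_left] at this
    simp only [conj_trivial] at this
    linarith

end Walk

/-! ### Maximal inequalities. -/

theorem two_mul_sum_partialSups_mul_le (x : ℕ → ℝ) (h0 : x 0 = 0) (n : ℕ) :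
    2 * ∑ k ∈ Finset.range n, partialSups x k * (x (k + 1) - x k) ≤
      2 * partialSups x n * x n - partialSups x n ^ 2 := by
  induction n with
  | zero => simp [h0]
  | succ n ih =>
    rw [Finset.sum_range_succ, ← Order.succ_eq_add_one, partialSups_succ, Order.succ_eq_add_one]
    rcases le_total (partialSups x n) (x (n + 1)) with h | h
    · rw [max_eq_right h]
      nlinarith [sq_nonneg (x (n + 1) - partialSups x n)]
    · rw [max_eq_left h]
      nlinarith

/-- A pathwise form of Doob's `L²` inequality: for a sum of independent centred steps, the sum on
the right has mean zero, each running maximum being independent of the next step. -/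
theorem partialSups_sq_le (x : ℕ → ℝ) (h0 : x 0 = 0) (n : ℕ) :
    partialSups x n ^ 2 ≤
      4 * x n ^ 2 - 4 * ∑ k ∈ Finset.range n, partialSups x k * (x (k + 1) - x k) := by
  nlinarith [two_mul_sum_partialSups_mul_le x h0 n, sq_nonneg (partialSups x n - 2 * x n)]

theorem partialSups_nonneg_of_zero {x : ℕ → ℝ} (h0 : 0 ≤ x 0) (n : ℕ) : 0 ≤ partialSups x n :=
  h0.trans (le_partialSups_of_le x (Nat.zero_le n))

section Maximal

variable {Ω : Type*} [MeasurableSpace Ω] {P : Measure Ω}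

theorem measurable_partialSups_apply {X : ℕ → Ω → ℝ} (hX : ∀ i, Measurable (X i)) (n : ℕ) :
    Measurable fun ω => partialSups (fun i => X i ω) n := by
  induction n with
  | zero => simpa using hX 0
  | succ n ih =>
    simp only [← Order.succ_eq_add_one, partialSups_succ]
    exact ih.sup (hX _)

theorem memLp_partialSups_apply {p : ENNReal} {X : ℕ → Ω → ℝ} (hX : ∀ i, MemLp (X i) p P)
    (n : ℕ) : MemLp (fun ω => partialSups (fun i => X i ω) n) p P := by
  induction n with
  | zero => simpa using hX 0
  | succ n ih =>
    simp only [← Order.succ_eq_add_one, partialSups_succ]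
    exact ih.sup (hX _)

/-- A functional of the partial sums before time `n` is independent of the increment `n`. -/
theorem indepFun_partialSups_sum [IsProbabilityMeasure P] {ξ : ℕ → Ω → ℝ}
    (hξ : ∀ i, Measurable (ξ i)) (hind : iIndepFun ξ P) (n : ℕ) :
    IndepFun (fun ω => partialSups (fun j => ∑ i ∈ Finset.range j, ξ i ω) n) (ξ n) P := by
  have h := hind.indepFun_finset (Finset.range n) {n} (by simp) hξ
  set φ : (Finset.range n → ℝ) → ℝ := fun y => partialSups
    (fun j => ∑ i ∈ Finset.range j, if hi : i ∈ Finset.range n then y ⟨i, hi⟩ else 0) n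
  have hφ : Measurable φ := by
    refine measurable_partialSups_apply
      (X := fun j (y : Finset.range n → ℝ) => ∑ i ∈ Finset.range j,
        if hi : i ∈ Finset.range n then y ⟨i, hi⟩ else 0) (fun j => ?_) n
    refine Finset.measurable_fun_sum _ fun i _ => ?_
    by_cases hi : i ∈ Finset.range n
    · simpa only [hi, dite_true] using measurable_pi_apply _
    · simp only [hi, dite_false, measurable_const]
  have h' := h.comp hφ (measurable_pi_apply (⟨n, by simp⟩ : ({n} : Finset ℕ)))
  suffices hfun : (fun ω => partialSups (fun j => ∑ i ∈ Finset.range j, ξ i ω) n) =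
      φ ∘ fun ω (i : Finset.range n) => ξ i ω by
    rw [hfun]
    exact h'
  ext1 ω
  simp only [φ, Function.comp_apply, partialSups_apply]
  refine Finset.sup'_congr _ rfl fun j hj => Finset.sum_congr rfl fun i hi => ?_
  have hin : i ∈ Finset.range n := by
    rw [Finset.mem_Iic] at hj
    rw [Finset.mem_range] at hi ⊢
    omega
  rw [dif_pos hin]

/-- Doob's maximal inequality in `L²` for a sum of independent centred random variables. -/
theorem integral_partialSups_sum_sq_le [IsProbabilityMeasure P] {ξ : ℕ → Ω → ℝ}
    (hξ : ∀ i, Measurable (ξ i)) (hind : iIndepFun ξ P) (hL2 : ∀ i, MemLp (ξ i) 2 P)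
    (hmean : ∀ i, ∫ ω, ξ i ω ∂P = 0) (n : ℕ) :
    ∫ ω, partialSups (fun j => ∑ i ∈ Finset.range j, ξ i ω) n ^ 2 ∂P ≤
      4 * ∑ i ∈ Finset.range n, ∫ ω, ξ i ω ^ 2 ∂P := by
  have hS : ∀ j, MemLp (fun ω => ∑ i ∈ Finset.range j, ξ i ω) 2 P := fun j =>
    memLp_finsetSum _ fun i _ => hL2 i
  have hM : ∀ j, MemLp (fun ω => partialSups (fun j => ∑ i ∈ Finset.range j, ξ i ω) j) 2 P :=
    memLp_partialSups_apply hS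
  have hcross : ∀ k, Integrable (fun ω =>
      partialSups (fun j => ∑ i ∈ Finset.range j, ξ i ω) k * ξ k ω) P := fun k =>
    (hM k).integrable_mul (hL2 k)
  have hcross0 : ∀ k, ∫ ω, partialSups (fun j => ∑ i ∈ Finset.range j, ξ i ω) k * ξ k ω ∂P = 0 := by
    intro k
    rw [(indepFun_partialSups_sum hξ hind k).integral_fun_mul_eq_mul_integral
      (hM k).aestronglyMeasurable (hL2 k).aestronglyMeasurable, hmean, mul_zero]
  have hvar : ∫ ω, (∑ i ∈ Finset.range n, ξ i ω) ^ 2 ∂P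
      = ∑ i ∈ Finset.range n, ∫ ω, ξ i ω ^ 2 ∂P := by
    have h1 := IndepFun.variance_sum (s := Finset.range n) (fun i _ => hL2 i)
      (fun i _ j _ hij => hind.indepFun hij)
    rw [variance_of_integral_eq_zero] at h1
    · simp only [Finset.sum_apply] at h1
      rw [h1]
      exact Finset.sum_congr rfl fun i _ => variance_of_integral_eq_zero (hξ i).aemeasurable (hmean i)
    · exact Finset.aemeasurable_sum _ fun i _ => (hξ i).aemeasurable
    · simp only [Finset.sum_apply]
      rw [integral_finsetSum _ fun i _ => (hL2 i).integrable one_le_two]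
      simp [hmean]
  calc ∫ ω, partialSups (fun j => ∑ i ∈ Finset.range j, ξ i ω) n ^ 2 ∂P
      ≤ ∫ ω, (4 * (∑ i ∈ Finset.range n, ξ i ω) ^ 2 - 4 * ∑ k ∈ Finset.range n,
          partialSups (fun j => ∑ i ∈ Finset.range j, ξ i ω) k * ξ k ω) ∂P := by
        refine integral_mono (hM n).integrable_sq (((hS n).integrable_sq.const_mul 4).sub
          ((integrable_finsetSum _ fun k _ => hcross k).const_mul 4)) fun ω => ?_
        refine (partialSups_sq_le _ (by simp) n).trans (le_of_eq ?_)
        simp [Finset.sum_range_succ]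
    _ = 4 * ∑ i ∈ Finset.range n, ∫ ω, ξ i ω ^ 2 ∂P := by
        rw [integral_sub ((hS n).integrable_sq.const_mul 4)
          ((integrable_finsetSum _ fun k _ => hcross k).const_mul 4), integral_const_mul,
          integral_const_mul, integral_finsetSum _ fun k _ => hcross k, hvar]
        simp [hcross0]

theorem integral_partialSups_abs_sum_sq_le [IsProbabilityMeasure P] {ξ : ℕ → Ω → ℝ}
    (hξ : ∀ i, Measurable (ξ i)) (hind : iIndepFun ξ P) (hL2 : ∀ i, MemLp (ξ i) 2 P)
    (hmean : ∀ i, ∫ ω, ξ i ω ∂P = 0) (n : ℕ) :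
    ∫ ω, partialSups (fun j => |∑ i ∈ Finset.range j, ξ i ω|) n ^ 2 ∂P ≤
      16 * ∑ i ∈ Finset.range n, ∫ ω, ξ i ω ^ 2 ∂P := by
  have hS : ∀ j, MemLp (fun ω => ∑ i ∈ Finset.range j, ξ i ω) 2 P := fun j =>
    memLp_finsetSum _ fun i _ => hL2 i
  have hS' : ∀ j, MemLp (fun ω => ∑ i ∈ Finset.range j, -ξ i ω) 2 P := fun j =>
    memLp_finsetSum _ fun i _ => (hL2 i).neg
  have h1 := integral_partialSups_sum_sq_le hξ hind hL2 hmean n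
  have h2 := integral_partialSups_sum_sq_le (ξ := fun i ω => -ξ i ω) (fun i => (hξ i).neg)
    (hind.comp (fun _ x => -x) fun _ => measurable_neg) (fun i => (hL2 i).neg)
    (fun i => by rw [integral_neg, hmean, neg_zero]) n
  simp only [neg_sq] at h2
  have i1 := (memLp_partialSups_apply hS n).integrable_sq
  have i2 := (memLp_partialSups_apply hS' n).integrable_sq
  have i3 := (memLp_partialSups_apply (fun j => (hS j).abs) n).integrable_sq
  have h3 : ∫ ω, partialSups (fun j => |∑ i ∈ Finset.range j, ξ i ω|) n ^ 2 ∂P ≤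
      ∫ ω, (2 * partialSups (fun j => ∑ i ∈ Finset.range j, ξ i ω) n ^ 2 +
        2 * partialSups (fun j => ∑ i ∈ Finset.range j, -ξ i ω) n ^ 2) ∂P := by
    refine integral_mono i3 ((i1.const_mul 2).add (i2.const_mul 2)) fun ω => ?_
    set A := partialSups (fun j => ∑ i ∈ Finset.range j, ξ i ω) n
    set B := partialSups (fun j => ∑ i ∈ Finset.range j, -ξ i ω) n
    have hA : 0 ≤ A := partialSups_nonneg_of_zero (by simp) n
    have hB : 0 ≤ B := partialSups_nonneg_of_zero (by simp) n
    -- Both one-sided maxima are nonnegative since the walk starts at `0`; hence the constant `16 =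
    -- 2 * (4 + 4)`.
    have hle : partialSups (fun j => |∑ i ∈ Finset.range j, ξ i ω|) n ≤ A + B := by
      refine partialSups_le _ _ _ fun j hj => ?_
      have e1 := le_partialSups_of_le (fun j => ∑ i ∈ Finset.range j, ξ i ω) hj
      have e2 := le_partialSups_of_le (fun j => ∑ i ∈ Finset.range j, -ξ i ω) hj
      simp only [Finset.sum_neg_distrib] at e2
      have e3 : B = partialSups (fun j => -∑ i ∈ Finset.range j, ξ i ω) n := by
        simp only [B, Finset.sum_neg_distrib]
      rw [abs_le]
      constructor <;> linarith
    have h0 : 0 ≤ partialSups (fun j => |∑ i ∈ Finset.range j, ξ i ω|) n :=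
      partialSups_nonneg_of_zero (abs_nonneg _) n
    have := pow_le_pow_left₀ h0 hle 2
    change _ ≤ 2 * A ^ 2 + 2 * B ^ 2
    nlinarith [sq_nonneg (A - B)]
  rw [integral_add (i1.const_mul 2) (i2.const_mul 2), integral_const_mul, integral_const_mul] at h3
  linarith

/-- The maximal excess of a bounded sub-Gaussian random walk over a linear boundary. -/
theorem integral_partialSups_abs_sum_sub_sq_le [IsProbabilityMeasure P] {η : ℕ → Ω → ℝ}
    (hη : ∀ i, Measurable (η i)) (hind : iIndepFun η P) {B : ℝ} (hB : ∀ i ω, |η i ω| ≤ B)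
    {κ : NNReal} (hκ : ∀ i, HasSubgaussianMGF (η i) κ P) {c : ℝ} (hc : 0 ≤ c) (n : ℕ) :
    ∫ ω, partialSups (fun j => |∑ i ∈ Finset.range j, η i ω| - c * j) n ^ 2 ∂P ≤
      ∑ j ∈ Finset.range (n + 1), 2 * B ^ 2 * ((j : ℝ) ^ 2 * Real.exp (-c ^ 2 / (2 * κ)) ^ j) := by
  set S : ℕ → Ω → ℝ := fun j ω => ∑ i ∈ Finset.range j, η i ω
  have hS : ∀ j, Measurable (S j) := fun j => Finset.measurable_fun_sum _ fun i _ => hη i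
  have hSb : ∀ j ω, |S j ω| ≤ B * j := by
    intro j ω
    refine (Finset.abs_sum_le_sum_abs _ _).trans ((Finset.sum_le_sum fun i _ => hB i ω).trans ?_)
    simp [mul_comm]
  set A : ℕ → Set Ω := fun j => {ω | c * j ≤ |S j ω|}
  have hA : ∀ j, MeasurableSet (A j) := fun j =>
    measurableSet_le measurable_const (hS j).norm
  have hind_int : ∀ j, Integrable ((A j).indicator fun _ : Ω => (B * j) ^ 2) P := fun j =>
    (integrable_const _).indicator (hA j)
  have hprob : ∀ j, P.real (A j) ≤ 2 * Real.exp (-c ^ 2 / (2 * κ)) ^ j := by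
    intro j
    have hcj : 0 ≤ c * j := by positivity
    have h1 := HasSubgaussianMGF.measure_sum_range_ge_le_of_iIndepFun hind (n := j)
      (fun i _ => hκ i) hcj
    have h2 := HasSubgaussianMGF.measure_sum_range_ge_le_of_iIndepFun (X := fun i => -η i)
      (hind.comp (fun _ x => -x) fun _ => measurable_neg) (n := j) (fun i _ => (hκ i).neg) hcj
    have he : Real.exp (-(c * j) ^ 2 / (2 * j * κ)) = Real.exp (-c ^ 2 / (2 * κ)) ^ j := by
      rw [← Real.exp_nat_mul]
      congr 1
      rcases eq_or_ne (j : ℝ) 0 with hj | hj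
      · simp [hj]
      rcases eq_or_ne (κ : ℝ) 0 with hk | hk
      · simp [hk]
      field_simp
    rw [he] at h1 h2
    have hsub : A j ⊆ {ω | c * j ≤ ∑ i ∈ Finset.range j, η i ω} ∪
        {ω | c * j ≤ ∑ i ∈ Finset.range j, (-η i) ω} := by
      intro ω hω
      change c * j ≤ |S j ω| at hω
      rcases le_abs.1 hω with h | h
      · exact Or.inl h
      · refine Or.inr ?_
        change c * j ≤ ∑ i ∈ Finset.range j, -η i ω
        rwa [Finset.sum_neg_distrib]
    calc P.real (A j) ≤ _ := measureReal_mono hsub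
      _ ≤ _ := measureReal_union_le _ _
      _ ≤ _ := by linarith
  have hpt : ∀ ω, partialSups (fun j => |S j ω| - c * j) n ^ 2 ≤
      ∑ j ∈ Finset.range (n + 1), (A j).indicator (fun _ : Ω => (B * j) ^ 2) ω := by
    intro ω
    have hnn : ∀ j, 0 ≤ (A j).indicator (fun _ : Ω => (B * j) ^ 2) ω := fun j =>
      Set.indicator_nonneg (fun _ _ => sq_nonneg _) _
    -- At a maximising time `j` the nonnegative excess puts `ω` in `A j` and is at most `B * j`;
    -- summing over all `j` replaces the random time.
    obtain ⟨j, hj, hjeq⟩ := exists_partialSups_eq (fun j => |S j ω| - c * j) n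
    have h0 : 0 ≤ partialSups (fun j => |S j ω| - c * j) n :=
      partialSups_nonneg_of_zero (by simp) n
    refine le_trans ?_ (Finset.single_le_sum (fun j _ => hnn j)
      (Finset.mem_range.2 (Nat.lt_succ_of_le hj)))
    rw [hjeq] at h0 ⊢
    have hω : ω ∈ A j := by
      change c * j ≤ |S j ω|
      linarith
    rw [Set.indicator_of_mem hω]
    have := hSb j ω
    have : 0 ≤ c * j := by positivity
    exact pow_le_pow_left₀ h0 (by linarith) 2
  calc ∫ ω, partialSups (fun j => |S j ω| - c * j) n ^ 2 ∂P
      ≤ ∫ ω, ∑ j ∈ Finset.range (n + 1), (A j).indicator (fun _ : Ω => (B * j) ^ 2) ω ∂P :=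
        integral_mono_of_nonneg (Eventually.of_forall fun ω => sq_nonneg _)
          (integrable_finsetSum _ fun j _ => hind_int j) (Eventually.of_forall hpt)
    _ = ∑ j ∈ Finset.range (n + 1), P.real (A j) * (B * j) ^ 2 := by
        rw [integral_finsetSum _ fun j _ => hind_int j]
        refine Finset.sum_congr rfl fun j _ => ?_
        rw [integral_indicator (hA j), setIntegral_const, smul_eq_mul]
    _ ≤ _ := by
        refine Finset.sum_le_sum fun j _ => ?_
        calc P.real (A j) * (B * j) ^ 2 ≤ 2 * Real.exp (-c ^ 2 / (2 * κ)) ^ j * (B * j) ^ 2 := by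
              gcongr
              exact hprob j
          _ = _ := by ring

end Maximal

/-! ### Excess over a line, by truncation. -/

/-- Truncation of a real number at level `K`. -/
noncomputable def truncAt (K x : ℝ) : ℝ := if |x| ≤ K then x else 0

theorem measurable_truncAt (K : ℝ) : Measurable (truncAt K) :=
  Measurable.ite (measurableSet_le measurable_id.norm measurable_const) measurable_id
    measurable_const

theorem abs_truncAt_le {K : ℝ} (hK : 0 ≤ K) (x : ℝ) : |truncAt K x| ≤ K := by
  rw [truncAt]
  split_ifs with h
  · exact h
  · simpa using hK

theorem abs_sub_truncAt_le (K x : ℝ) : |x - truncAt K x| ≤ |x| := by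
  rw [truncAt]
  split_ifs with h <;> simp

section Excess

variable {Ω : Type*} [MeasurableSpace Ω] {P : Measure Ω}

theorem tendsto_integral_sub_truncAt_sq {X : Ω → ℝ} (hX : Measurable X) (hX2 : MemLp X 2 P) :
    Tendsto (fun K : ℕ => ∫ ω, (X ω - truncAt K (X ω)) ^ 2 ∂P) atTop (𝓝 0) := by
  have h := tendsto_integral_of_dominated_convergence (μ := P) (f := fun _ => (0 : ℝ))
    (F := fun (K : ℕ) ω => (X ω - truncAt K (X ω)) ^ 2) (fun ω => X ω ^ 2)
    (fun K => ((hX.sub ((measurable_truncAt K).comp hX)).pow_const 2).aestronglyMeasurable)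
    hX2.integrable_sq (fun K => Eventually.of_forall fun ω => ?_)
    (Eventually.of_forall fun ω => ?_)
  · simpa using h
  · rw [Real.norm_eq_abs, abs_of_nonneg (sq_nonneg _), sq_le_sq]
    exact abs_sub_truncAt_le _ _
  · refine tendsto_const_nhds.congr' ?_
    obtain ⟨N, hN⟩ := exists_nat_ge |X ω|
    filter_upwards [eventually_ge_atTop N] with K hK
    have : |X ω| ≤ K := hN.trans (by exact_mod_cast hK)
    simp [truncAt, this]

/-- The squared maximal excess of a centred random walk over a linear boundary is negligible with
respect to the number of steps, uniformly under rearrangements of the steps. -/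
theorem exists_integral_partialSups_excess_sq_le [IsProbabilityMeasure P] {ξ : ℕ → Ω → ℝ}
    (hξ : ∀ i, Measurable (ξ i)) (hind : iIndepFun ξ P)
    (hident : ∀ i, IdentDistrib (ξ i) (ξ 0) P P) (hL2 : MemLp (ξ 0) 2 P)
    (hmean : ∫ ω, ξ 0 ω ∂P = 0) {c ε : ℝ} (hc : 0 < c) (hε : 0 < ε) :
    ∃ C : ℝ, ∀ g : ℕ → ℕ, g.Injective → ∀ n : ℕ,
      ∫ ω, partialSups (fun j => |∑ i ∈ Finset.range j, ξ (g i) ω| - c * j) n ^ 2 ∂P ≤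
        ε * n + C := by
  -- `ε / 32` absorbs the factor `16` of the maximal inequality and the `2` from `(a + b)² ≤ 2 a² +
  -- 2 b²`.
  obtain ⟨K, hK, hK0⟩ := (((tendsto_integral_sub_truncAt_sq (hξ 0) hL2).eventually
    (gt_mem_nhds (show (0 : ℝ) < ε / 32 by positivity))).and
    (eventually_gt_atTop 0)).exists
  set e : ℝ := ∫ ω, truncAt K (ξ 0 ω) ∂P
  -- Truncation destroys centring: `e` is moved between the two parts so that both have mean zero
  -- along the walk.
  set f₁ : ℝ → ℝ := fun x => truncAt K x - e
  set f₂ : ℝ → ℝ := fun x => x - truncAt K x + e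
  have hf₁ : Measurable f₁ := (measurable_truncAt K).sub_const e
  have hf₂ : Measurable f₂ := (measurable_id.sub (measurable_truncAt K)).add_const e
  have htr : ∀ x, |truncAt K x| ≤ K := abs_truncAt_le (Nat.cast_nonneg K)
  have htrL2 : MemLp (fun ω => truncAt K (ξ 0 ω)) 2 P :=
    MemLp.of_bound ((measurable_truncAt K).comp (hξ 0)).aestronglyMeasurable K
      (Eventually.of_forall fun ω => htr _)
  have hW : MemLp (fun ω => ξ 0 ω - truncAt K (ξ 0 ω)) 2 P := hL2.sub htrL2
  have hWmean : ∫ ω, (ξ 0 ω - truncAt K (ξ 0 ω)) ∂P = -e := by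
    rw [integral_sub (hL2.integrable one_le_two) (htrL2.integrable one_le_two), hmean, zero_sub]
  have hf₂L2 : MemLp (fun ω => f₂ (ξ 0 ω)) 2 P := hW.add (memLp_const e)
  have hf₂mean : ∫ ω, f₂ (ξ 0 ω) ∂P = 0 := by
    change ∫ ω, (ξ 0 ω - truncAt K (ξ 0 ω) + e) ∂P = 0
    rw [integral_add (hW.integrable one_le_two) (integrable_const _), hWmean]
    simp
  have hf₂sq : ∫ ω, f₂ (ξ 0 ω) ^ 2 ∂P ≤ ε / 32 := by
    have h1 := variance_le_expectation_sq (μ := P) hW.aestronglyMeasurable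
    rw [variance_eq_integral hW.aestronglyMeasurable.aemeasurable, hWmean] at h1
    simp only [sub_neg_eq_add, Pi.pow_apply] at h1
    exact h1.trans hK.le
  set κ : NNReal := (‖(K : ℝ) - -K‖₊ / 2) ^ 2
  have hsub : ∀ i, HasSubgaussianMGF (fun ω => f₁ (ξ i ω)) κ P := by
    intro i
    have h := hasSubgaussianMGF_of_mem_Icc (μ := P) (X := fun ω => truncAt K (ξ i ω))
      (a := -K) (b := K) ((measurable_truncAt K).comp (hξ i)).aemeasurable
      (Eventually.of_forall fun ω => abs_le.1 (htr _))
    have he : ∫ ω, truncAt K (ξ i ω) ∂P = e :=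
      ((hident i).comp (measurable_truncAt K)).integral_eq
    rwa [he] at h
  set B : ℝ := K + |e|
  have hB : ∀ x, |f₁ x| ≤ B := fun x => (abs_sub _ _).trans (by
    have := htr x
    simp only [B]
    linarith)
  set q : ℝ := Real.exp (-c ^ 2 / (2 * κ))
  -- Needed because division by `κ = 0` would give `q = 1` and lose summability.
  have hκpos : (0 : ℝ) < κ := by
    have hK0' : (0 : ℝ) < K := by exact_mod_cast hK0
    have : 0 < ‖(K : ℝ) - -K‖ := norm_pos_iff.2 (by linarith)
    simp only [κ, NNReal.coe_pow, NNReal.coe_div, coe_nnnorm]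
    positivity
  have hq1 : ‖q‖ < 1 := by
    rw [Real.norm_of_nonneg (Real.exp_pos _).le, Real.exp_lt_one_iff]
    exact div_neg_of_neg_of_pos (by nlinarith) (by positivity)
  have hsummable := (summable_pow_mul_geometric_of_norm_lt_one 2 hq1).mul_left (2 * B ^ 2)
  -- The constant depends only on the common law of the steps, hence not on `g`.
  refine ⟨2 * ∑' j : ℕ, 2 * B ^ 2 * ((j : ℝ) ^ 2 * q ^ j), fun g hg n => ?_⟩
  have hindg : iIndepFun (fun i => ξ (g i)) P := hind.precomp hg
  have hgL2 : ∀ i, MemLp (ξ (g i)) 2 P := fun i => (hident (g i)).memLp_iff.2 hL2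
  have h₁ := integral_partialSups_abs_sum_sub_sq_le (η := fun i ω => f₁ (ξ (g i) ω))
    (fun i => hf₁.comp (hξ _)) (hindg.comp (fun _ => f₁) fun _ => hf₁) (fun i ω => hB _)
    (fun i => hsub _) hc.le n
  have h₂ := integral_partialSups_abs_sum_sq_le (ξ := fun i ω => f₂ (ξ (g i) ω))
    (fun i => hf₂.comp (hξ _)) (hindg.comp (fun _ => f₂) fun _ => hf₂)
    (fun i => ((hident (g i)).comp hf₂).memLp_iff.2 hf₂L2)
    (fun i => ((hident (g i)).comp hf₂).integral_eq.trans hf₂mean) n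
  have h₂' : ∑ i ∈ Finset.range n, ∫ ω, f₂ (ξ (g i) ω) ^ 2 ∂P ≤ n * (ε / 32) := by
    refine (Finset.sum_le_card_nsmul _ _ (ε / 32) fun i _ => ?_).trans (by simp)
    exact ((hident (g i)).comp (hf₂.pow_const 2)).integral_eq.trans_le hf₂sq
  have h₁' := h₁.trans (hsummable.sum_le_tsum _ fun j _ => by positivity)
  have hf₁L2 : ∀ i, MemLp (fun ω => f₁ (ξ (g i) ω)) 2 P := fun i =>
    MemLp.of_bound (hf₁.comp (hξ _)).aestronglyMeasurable B (Eventually.of_forall fun ω => hB _)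
  have hf₂L2' : ∀ i, MemLp (fun ω => f₂ (ξ (g i) ω)) 2 P := fun i =>
    ((hident (g i)).comp hf₂).memLp_iff.2 hf₂L2
  have i1 := (memLp_partialSups_apply (X := fun j ω => |∑ i ∈ Finset.range j, f₁ (ξ (g i) ω)| - c * j)
    (fun j => (memLp_finsetSum _ fun i _ => hf₁L2 i).abs.sub (memLp_const (c * j))) n).integrable_sq
  have i2 := (memLp_partialSups_apply (X := fun j ω => |∑ i ∈ Finset.range j, f₂ (ξ (g i) ω)|)
    (fun j => (memLp_finsetSum _ fun i _ => hf₂L2' i).abs) n).integrable_sq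
  have hmono : ∫ ω, partialSups (fun j => |∑ i ∈ Finset.range j, ξ (g i) ω| - c * j) n ^ 2 ∂P ≤
      ∫ ω, (2 * partialSups (fun j => |∑ i ∈ Finset.range j, f₁ (ξ (g i) ω)| - c * j) n ^ 2 +
        2 * partialSups (fun j => |∑ i ∈ Finset.range j, f₂ (ξ (g i) ω)|) n ^ 2) ∂P := by
    refine integral_mono_of_nonneg (Eventually.of_forall fun ω => sq_nonneg _)
      ((i1.const_mul 2).add (i2.const_mul 2)) (Eventually.of_forall fun ω => ?_)
    have h0 : 0 ≤ partialSups (fun j => |∑ i ∈ Finset.range j, ξ (g i) ω| - c * j) n :=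
      partialSups_nonneg_of_zero (by simp) n
    have hle : partialSups (fun j => |∑ i ∈ Finset.range j, ξ (g i) ω| - c * j) n ≤
        partialSups (fun j => |∑ i ∈ Finset.range j, f₁ (ξ (g i) ω)| - c * j) n +
        partialSups (fun j => |∑ i ∈ Finset.range j, f₂ (ξ (g i) ω)|) n := by
      refine partialSups_le _ _ _ fun j hj => ?_
      have e1 := le_partialSups_of_le
        (fun j : ℕ => |∑ i ∈ Finset.range j, f₁ (ξ (g i) ω)| - c * j) hj
      have e2 := le_partialSups_of_le (fun j => |∑ i ∈ Finset.range j, f₂ (ξ (g i) ω)|) hj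
      have e3 : ∑ i ∈ Finset.range j, ξ (g i) ω = ∑ i ∈ Finset.range j, f₁ (ξ (g i) ω) +
          ∑ i ∈ Finset.range j, f₂ (ξ (g i) ω) := by
        rw [← Finset.sum_add_distrib]
        exact Finset.sum_congr rfl fun i _ => by simp only [f₁, f₂]; ring
      have e4 := abs_add_le (∑ i ∈ Finset.range j, f₁ (ξ (g i) ω))
        (∑ i ∈ Finset.range j, f₂ (ξ (g i) ω))
      rw [← e3] at e4
      linarith
    have := pow_le_pow_left₀ h0 hle 2
    refine this.trans ?_
    exact add_sq_le.trans (by linarith)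
  rw [integral_add (i1.const_mul 2) (i2.const_mul 2), integral_const_mul, integral_const_mul] at hmono
  linarith

end Excess

/-! ### Central limit theorem under `L²` approximation. -/

section Limit

variable {Ω : Type*} [MeasurableSpace Ω] {P : Measure Ω} [IsProbabilityMeasure P]

/-- The variance of `s * X + Y` is a nonnegative quadratic in `s`, so its discriminant is
nonpositive. -/
theorem covariance_sq_le_variance_mul_variance {X Y : Ω → ℝ} (hX : MemLp X 2 P)
    (hY : MemLp Y 2 P) : covariance X Y P ^ 2 ≤ variance X P * variance Y P := by
  have h : ∀ s : ℝ, 0 ≤ variance X P * (s * s) + (2 * covariance X Y P) * s + variance Y P := by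
    intro s
    have h1 := variance_nonneg (fun ω => s * X ω + Y ω) P
    rw [variance_fun_add (hX.const_mul s) hY, variance_const_mul, covariance_const_mul_left] at h1
    linarith
  have := discrim_le_zero h
  rw [discrim] at this
  linarith

/-- The Gaussian law has no atoms, so every half-line is a continuity set. -/
theorem tendsto_real_of_tendstoInDistribution_gaussianReal {Ω' : Type*} [MeasurableSpace Ω']
    {P' : Measure Ω'} [IsProbabilityMeasure P'] {U : ℕ → Ω → ℝ} {Y : Ω' → ℝ}
    (hY : P'.map Y = gaussianReal 0 1)
    (hU : TendstoInDistribution U atTop Y (fun _ => P) P') (x : ℝ) :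
    Tendsto (fun n => P.real {ω | U n ω ≤ x}) atTop (𝓝 (cdf (gaussianReal 0 1) x)) := by
  have hna : NullSingletonClass (gaussianReal 0 1) :=
    nullSingletonClass_gaussianReal one_ne_zero
  have h := ProbabilityMeasure.tendsto_measure_of_null_frontier_of_tendsto' hU.tendsto
    (E := Set.Iic x) (by
      change P'.map Y (frontier (Set.Iic x)) = 0
      rw [hY, frontier_Iic]
      exact measure_singleton x)
  have h' := (ENNReal.tendsto_toReal (a := P'.map Y (Set.Iic x))
    (by rw [hY]; exact measure_ne_top _ _)).comp h
  rw [cdf_eq_real]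
  convert h' using 1
  · ext1 n
    change _ = (P.map (U n) (Set.Iic x)).toReal
    rw [Measure.map_apply_of_aemeasurable (hU.forall_aemeasurable n) measurableSet_Iic]
    rfl
  · rw [hY]
    rfl

variable {X L : ℕ → Ω → ℝ}

theorem tendsto_variance_sub_sum_div (hX : MemLp (X 0) 2 P)
    (hident : ∀ i, IdentDistrib (X i) (X 0) P P) (hL : ∀ n, MemLp (L n) 2 P)
    (hD : Tendsto (fun n : ℕ => (∫ ω, (L n ω - ∑ i ∈ Finset.range n, X i ω) ^ 2 ∂P) / n) atTop
      (𝓝 0)) :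
    Tendsto (fun n : ℕ => variance (fun ω => L n ω - ∑ i ∈ Finset.range n, X i ω) P / n) atTop
      (𝓝 0) := by
  refine tendsto_of_tendsto_of_tendsto_of_le_of_le tendsto_const_nhds hD
    (fun n => div_nonneg (variance_nonneg _ _) (Nat.cast_nonneg n)) fun n => ?_
  have hS : MemLp (fun ω => ∑ i ∈ Finset.range n, X i ω) 2 P :=
    memLp_finsetSum _ fun i _ => (hident i).memLp_iff.2 hX
  exact div_le_div_of_nonneg_right
    (variance_le_expectation_sq ((hL n).sub hS).aestronglyMeasurable) (Nat.cast_nonneg n)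

/-- Write `L = S + D`. The variance of `D` is `o(n)`, and by Cauchy–Schwarz so is the covariance of
`S` and `D`. -/
theorem tendsto_variance_div (hX : MemLp (X 0) 2 P) (hind : iIndepFun X P)
    (hident : ∀ i, IdentDistrib (X i) (X 0) P P) (hL : ∀ n, MemLp (L n) 2 P)
    (hD : Tendsto (fun n : ℕ => (∫ ω, (L n ω - ∑ i ∈ Finset.range n, X i ω) ^ 2 ∂P) / n) atTop
      (𝓝 0)) :
    Tendsto (fun n : ℕ => variance (L n) P / n) atTop (𝓝 (variance (X 0) P)) := by
  have hXi : ∀ i, MemLp (X i) 2 P := fun i => (hident i).memLp_iff.2 hX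
  set S : ℕ → Ω → ℝ := fun n ω => ∑ i ∈ Finset.range n, X i ω
  set D : ℕ → Ω → ℝ := fun n ω => L n ω - S n ω
  have hS : ∀ n, MemLp (S n) 2 P := fun n => memLp_finsetSum _ fun i _ => hXi i
  have hDL : ∀ n, MemLp (D n) 2 P := fun n => (hL n).sub (hS n)
  have hvS : ∀ n, variance (S n) P = n * variance (X 0) P := by
    intro n
    have h := IndepFun.variance_sum (s := Finset.range n) (fun i _ => hXi i)
      (fun i _ j _ hij => hind.indepFun hij)
    have hfun : S n = ∑ i ∈ Finset.range n, X i := by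
      ext ω
      simp [S]
    rw [hfun, h, Finset.sum_congr rfl fun i _ => (hident i).variance_eq]
    simp
  have hvD : Tendsto (fun n : ℕ => variance (D n) P / n) atTop (𝓝 0) :=
    tendsto_variance_sub_sum_div hX hident hL hD
  have hcov : Tendsto (fun n : ℕ => covariance (S n) (D n) P / n) atTop (𝓝 0) := by
    have h1 : Tendsto (fun n : ℕ => √(variance (X 0) P * (variance (D n) P / n))) atTop (𝓝 0) := by
      have := (hvD.const_mul (variance (X 0) P)).sqrt
      simpa using this
    refine squeeze_zero_norm (fun n => ?_) h1
    rw [Real.norm_eq_abs]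
    apply Real.abs_le_sqrt
    rcases eq_or_ne (n : ℝ) 0 with hn | hn
    · simp [hn]
    have h2 := covariance_sq_le_variance_mul_variance (hS n) (hDL n)
    rw [hvS] at h2
    rw [div_pow, div_le_iff₀ (by positivity)]
    calc _ ≤ _ := h2
      _ = _ := by field_simp
  have hsum : Tendsto (fun n : ℕ => variance (X 0) P + 2 * (covariance (S n) (D n) P / n) +
      variance (D n) P / n) atTop (𝓝 (variance (X 0) P)) := by
    have := ((hcov.const_mul 2).const_add (variance (X 0) P)).add hvD
    simpa using this
  refine hsum.congr' ?_
  filter_upwards [eventually_gt_atTop 0] with n hn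
  have hn' : (n : ℝ) ≠ 0 := by exact_mod_cast hn.ne'
  have hfun : L n = fun ω => S n ω + D n ω := by
    ext ω
    simp only [D]
    ring
  rw [hfun, variance_fun_add (hS n) (hDL n), hvS]
  field_simp

/-- Central limit theorem for an `L²`-approximation of a sum of i.i.d. random variables. -/
theorem tendstoInDistribution_of_sub_sum {Ω' : Type*} [MeasurableSpace Ω'] {P' : Measure Ω'}
    [IsProbabilityMeasure P'] {Y : Ω' → ℝ}
    (hY : HasLaw Y (gaussianReal 0 (variance (X 0) P).toNNReal) P')
    (hX : MemLp (X 0) 2 P) (hind : iIndepFun X P)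
    (hident : ∀ i, IdentDistrib (X i) (X 0) P P) (hL : ∀ n, MemLp (L n) 2 P)
    (hD : Tendsto (fun n : ℕ => (∫ ω, (L n ω - ∑ i ∈ Finset.range n, X i ω) ^ 2 ∂P) / n) atTop
      (𝓝 0)) :
    TendstoInDistribution (fun (n : ℕ) ω => (√n)⁻¹ * (L n ω - ∫ ω', L n ω' ∂P)) atTop Y
      (fun _ => P) P' := by
  have hXi : ∀ i, MemLp (X i) 2 P := fun i => (hident i).memLp_iff.2 hX
  have hS : ∀ n, MemLp (fun ω => ∑ i ∈ Finset.range n, X i ω) 2 P := fun n =>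
    memLp_finsetSum _ fun i _ => hXi i
  have hvD := tendsto_variance_sub_sum_div hX hident hL hD
  -- Slutsky: by Chebyshev, the difference from the normalised i.i.d. sum tends to `0` in
  -- probability.
  refine tendstoInDistribution_of_tendstoInMeasure_sub _ _
    (tendstoInDistribution_inv_sqrt_mul_sum_sub hY hX hind hident) ?_
    (fun n => ((hL n).aestronglyMeasurable.aemeasurable.sub_const _).const_mul _)
  rw [tendstoInMeasure_iff_norm]
  intro ε hε
  have hbound : Tendsto (fun n : ℕ => ENNReal.ofReal
      (variance (fun ω => L n ω - ∑ i ∈ Finset.range n, X i ω) P / n / ε ^ 2)) atTop (𝓝 0) := by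
    have := ENNReal.tendsto_ofReal (hvD.div_const (ε ^ 2))
    simpa using this
  refine tendsto_of_tendsto_of_tendsto_of_le_of_le' tendsto_const_nhds hbound
    (Eventually.of_forall fun n => zero_le) ?_
  filter_upwards [eventually_gt_atTop 0] with n hn
  have hn0 : (0 : ℝ) < n := by exact_mod_cast hn
  have hsn : 0 < √(n : ℝ) := Real.sqrt_pos.2 hn0
  have hcheb := meas_ge_le_variance_div_sq ((hL n).sub (hS n)) (mul_pos hε hsn)
  have hmeanS : ∫ ω, ∑ i ∈ Finset.range n, X i ω ∂P = n * ∫ ω, X 0 ω ∂P := by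
    rw [integral_finsetSum _ fun i _ => (hXi i).integrable one_le_two,
      Finset.sum_congr rfl fun i _ => (hident i).integral_eq]
    simp
  refine (measure_mono fun ω hω => ?_).trans (hcheb.trans (le_of_eq ?_))
  · change ε ≤ ‖(√n)⁻¹ * (L n ω - ∫ ω', L n ω' ∂P) -
      (√n)⁻¹ * (∑ k ∈ Finset.range n, X k ω - n * ∫ ω', X 0 ω' ∂P) - 0‖ at hω
    change ε * √n ≤ |(L n ω - ∑ i ∈ Finset.range n, X i ω) -
      ∫ ω', (L n ω' - ∑ i ∈ Finset.range n, X i ω') ∂P|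
    rw [integral_sub ((hL n).integrable one_le_two) ((hS n).integrable one_le_two), hmeanS]
    rw [sub_zero, ← mul_sub, norm_mul, norm_inv, Real.norm_of_nonneg hsn.le,
      le_inv_mul_iff₀ hsn, mul_comm, Real.norm_eq_abs] at hω
    refine hω.trans (le_of_eq ?_)
    congr 1
    ring
  · congr 1
    rw [mul_pow, Real.sq_sqrt hn0.le]
    change variance (fun ω => L n ω - ∑ i ∈ Finset.range n, X i ω) P / _ = _
    field_simp

/-- The free normalisation `s` serves both `Var L_n` and `σ² n`. -/
theorem tendsto_real_standardized_le (hv : 0 < variance (X 0) P) (hX : MemLp (X 0) 2 P)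
    (hind : iIndepFun X P) (hident : ∀ i, IdentDistrib (X i) (X 0) P P)
    (hL : ∀ n, MemLp (L n) 2 P)
    (hD : Tendsto (fun n : ℕ => (∫ ω, (L n ω - ∑ i ∈ Finset.range n, X i ω) ^ 2 ∂P) / n) atTop
      (𝓝 0)) {s : ℕ → ℝ} (hs : Tendsto (fun n : ℕ => s n / n) atTop (𝓝 (variance (X 0) P)))
    (x : ℝ) :
    Tendsto (fun n : ℕ => P.real {ω | (L n ω - ∫ ω', L n ω' ∂P) / √(s n) ≤ x}) atTop
      (𝓝 (cdf (gaussianReal 0 1) x)) := by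
  set v := variance (X 0) P
  have h1 := tendstoInDistribution_of_sub_sum (Y := id) (P' := gaussianReal 0 v.toNNReal)
    ⟨aemeasurable_id, Measure.map_id⟩ hX hind hident hL hD
  have hc : Tendsto (fun n : ℕ => (√(s n / n))⁻¹) atTop (𝓝 (√v)⁻¹) :=
    hs.sqrt.inv₀ (Real.sqrt_pos.2 hv).ne'
  have hcm : TendstoInMeasure P (fun (n : ℕ) (_ : Ω) => (√(s n / n))⁻¹) atTop
      (fun _ => (√v)⁻¹) := by
    refine tendstoInMeasure_of_tendsto_ae (fun n => aestronglyMeasurable_const) ?_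
    exact Eventually.of_forall fun _ => hc
  have h2 := h1.continuous_comp_prodMk_of_tendstoInMeasure_const
    (g := fun p : ℝ × ℝ => p.2 * p.1) (by fun_prop) hcm (fun n => aemeasurable_const)
  have hlaw : (gaussianReal 0 v.toNNReal).map (fun y => (√v)⁻¹ * id y) = gaussianReal 0 1 := by
    simp only [id]
    rw [gaussianReal_map_const_mul, mul_zero]
    congr 1
    ext
    push_cast
    rw [Real.coe_toNNReal _ hv.le, inv_pow, Real.sq_sqrt hv.le, inv_mul_cancel₀ hv.ne']
  refine (tendsto_real_of_tendstoInDistribution_gaussianReal hlaw h2 x).congr' ?_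
  filter_upwards [eventually_gt_atTop 0] with n hn
  have hn0 : (0 : ℝ) < n := by exact_mod_cast hn
  have hsn : √(n : ℝ) ≠ 0 := (Real.sqrt_pos.2 hn0).ne'
  congr 1
  ext ω
  change (√(s n / n))⁻¹ * ((√n)⁻¹ * (L n ω - ∫ ω', L n ω' ∂P)) ≤ x ↔
    (L n ω - ∫ ω', L n ω' ∂P) / √(s n) ≤ x
  rw [Real.sqrt_div' _ hn0.le, inv_div, ← mul_assoc, div_mul_eq_mul_div,
    mul_inv_cancel₀ hsn, one_div, inv_mul_eq_div]

end Limit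

/-! ### Comparison of the perimeter with the displacement along the drift. -/

/-- Reversal of the order of the first `n` natural numbers. -/
def reflectBelow (n i : ℕ) : ℕ := if i < n then n - 1 - i else i

theorem reflectBelow_injective (n : ℕ) : (reflectBelow n).Injective := by
  intro i j h
  simp only [reflectBelow] at h
  split_ifs at h <;> omega

/-- The walk seen backward from its endpoint; it controls the hull near `S_n` as the forward walk
does near `S_0`. -/
theorem sum_range_reflectBelow (f : ℕ → ℝ) (n : ℕ) {k : ℕ} (hk : k ≤ n) :
    ∑ i ∈ Finset.range k, f (reflectBelow n i) =
      ∑ i ∈ Finset.range n, f i - ∑ i ∈ Finset.range (n - k), f i := by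
  induction k with
  | zero => simp
  | succ k ih =>
    have h1 : n - k = n - (k + 1) + 1 := by omega
    have h2 : reflectBelow n k = n - (k + 1) := by
      simp only [reflectBelow]
      split_ifs <;> omega
    rw [Finset.sum_range_succ, ih (by omega), h1, Finset.sum_range_succ, h2]
    ring

section Comparison

variable {Ω : Type*} {Z : ℕ → Ω → Plane}

theorem inner_walk (u : Plane) (n : ℕ) (ω : Ω) :
    inner ℝ u (walk Z n ω) = ∑ i ∈ Finset.range n, inner ℝ u (Z i ω) :=
  inner_sum _ _ _

theorem sum_two_mul_inner_le_hullPerimeter {u : Plane} (hu : ‖u‖ = 1) (n : ℕ) (ω : Ω) :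
    ∑ i ∈ Finset.range n, 2 * inner ℝ u (Z i ω) ≤ hullPerimeter Z n ω := by
  refine le_trans ?_ (two_mul_norm_walk_le_hullPerimeter Z n ω)
  rw [← Finset.mul_sum, ← inner_walk]
  have := real_inner_le_norm u (walk Z n ω)
  rw [hu] at this
  linarith

/-- The hull perimeter of a walk exceeds twice its displacement in the direction `u` only by
excesses of the forward and backward walks over linear boundaries. -/
theorem hullPerimeter_sub_le {u : Plane} (hu : ‖u‖ = 1) {δ : ℝ} (hδ : 0 < δ) (m : ℝ)
    (n : ℕ) (ω : Ω) {y t : ℕ → ℝ} (hy : ∀ i, y i = inner ℝ (perp u) (Z i ω))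
    (ht : ∀ i, t i = inner ℝ u (Z i ω) - m) :
    hullPerimeter Z n ω - ∑ i ∈ Finset.range n, 2 * inner ℝ u (Z i ω) ≤
      2 * (δ⁻¹ * (partialSups (fun j => |∑ i ∈ Finset.range j, y i| - δ * (m / 2) * j) n +
        partialSups (fun j => |∑ i ∈ Finset.range j, y (reflectBelow n i)| - δ * (m / 2) * j) n) +
        (partialSups (fun j => |∑ i ∈ Finset.range j, t i| - m / 2 * j) n +
        partialSups (fun j => |∑ i ∈ Finset.range j, t (reflectBelow n i)| - m / 2 * j) n)) +
      3 * δ * partialSups (fun j => |∑ i ∈ Finset.range j, y i|) n := by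
  have hY : ∀ j, (inner ℝ (perp u) (walk Z j ω) : ℝ) = ∑ i ∈ Finset.range j, y i := fun j => by
    rw [inner_walk]
    exact Finset.sum_congr rfl fun i _ => (hy i).symm
  have hT : ∀ j : ℕ, (inner ℝ u (walk Z j ω) : ℝ) = m * j + ∑ i ∈ Finset.range j, t i := fun j => by
    rw [inner_walk, Finset.sum_congr rfl fun i _ => ht i, Finset.sum_sub_distrib]
    simp
    ring
  set AY := partialSups (fun j : ℕ => |∑ i ∈ Finset.range j, y i| - δ * (m / 2) * j) n with hAY
  set BY := partialSups
    (fun j : ℕ => |∑ i ∈ Finset.range j, y (reflectBelow n i)| - δ * (m / 2) * j) n with hBY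
  set AT := partialSups (fun j : ℕ => |∑ i ∈ Finset.range j, t i| - m / 2 * j) n with hAT
  set BT := partialSups
    (fun j : ℕ => |∑ i ∈ Finset.range j, t (reflectBelow n i)| - m / 2 * j) n with hBT
  set M := partialSups (fun j => |∑ i ∈ Finset.range j, y i|) n with hM
  -- The drift `m * j` is split in halves: one absorbs the longitudinal fluctuation up to `AT`, the
  -- other, times `δ`, the transversal one up to `AY`. So `a = δ⁻¹ * AY + AT` suffices; `b` is the
  -- analogue for the reversed walk.
  have key := hullPerimeter_le Z n ω hu (M := M) (a := δ⁻¹ * AY + AT)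
    (b := inner ℝ u (walk Z n ω) + δ⁻¹ * BY + BT) hδ (fun j hj => ?_) (fun j hj => ?_)
    (fun j hj => ?_)
  · rw [← Finset.mul_sum, ← inner_walk]
    linarith
  · rw [hY]
    exact le_partialSups_of_le (fun j => |∑ i ∈ Finset.range j, y i|) hj
  · have e1 := le_partialSups_of_le
      (fun j : ℕ => |∑ i ∈ Finset.range j, y i| - δ * (m / 2) * j) hj
    have e2 := le_partialSups_of_le (fun j : ℕ => |∑ i ∈ Finset.range j, t i| - m / 2 * j) hj
    rw [← hAY] at e1
    rw [← hAT] at e2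
    have e3 := neg_abs_le (∑ i ∈ Finset.range j, t i)
    rw [hY, hT]
    have e4 : δ * (m * j + ∑ i ∈ Finset.range j, t i + (δ⁻¹ * AY + AT)) =
        AY + δ * (m * j + ∑ i ∈ Finset.range j, t i + AT) := by
      field_simp
      ring
    have e5 : δ * (m / 2 * j) ≤ δ * (m * j + ∑ i ∈ Finset.range j, t i + AT) :=
      mul_le_mul_of_nonneg_left (by linarith) hδ.le
    rw [e4]
    linarith
  · have hnj : n - j ≤ n := Nat.sub_le _ _
    have e1 := le_partialSups_of_le
      (fun j : ℕ => |∑ i ∈ Finset.range j, y (reflectBelow n i)| - δ * (m / 2) * j) hnj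
    have e2 := le_partialSups_of_le
      (fun j : ℕ => |∑ i ∈ Finset.range j, t (reflectBelow n i)| - m / 2 * j) hnj
    rw [← hBY] at e1
    rw [← hBT] at e2
    simp only [sum_range_reflectBelow _ n hnj, Nat.sub_sub_self hj] at e1 e2
    rw [Nat.cast_sub hj] at e1 e2
    rw [hY, hY, hT, hT, abs_sub_comm]
    have e3 := neg_abs_le (∑ i ∈ Finset.range n, t i - ∑ i ∈ Finset.range j, t i)
    have e4 : δ * (m * n + ∑ i ∈ Finset.range n, t i + δ⁻¹ * BY + BT -
        (m * j + ∑ i ∈ Finset.range j, t i)) =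
        BY + δ * (m * (n - j) + (∑ i ∈ Finset.range n, t i - ∑ i ∈ Finset.range j, t i) + BT) := by
      field_simp
      ring
    have e5 : δ * (m / 2 * (n - j)) ≤
        δ * (m * (n - j) + (∑ i ∈ Finset.range n, t i - ∑ i ∈ Finset.range j, t i) + BT) :=
      mul_le_mul_of_nonneg_left (by linarith) hδ.le
    rw [e4]
    linarith

variable [MeasurableSpace Ω] {P : Measure Ω} [IsProbabilityMeasure P]

/-- The hull perimeter is approximated in `L²`, up to an error which is negligible with respect to
`√n`, by twice the displacement in the direction of the drift. -/
theorem exists_hullPerimeter_sub_le (hmeas : ∀ i, Measurable (Z i)) (hindep : iIndepFun Z P)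
    (hident : ∀ i, IdentDistrib (Z i) (Z 0) P P) (hmoment : MemLp (Z 0) 2 P) {u : Plane}
    (hu : ‖u‖ = 1) {m : ℝ} (hm : 0 < m) (hmean : ∫ ω, Z 0 ω ∂P = m • u) {r : ℝ} (hr : 0 < r) :
    ∃ C : ℝ, ∀ n : ℕ, ∃ R : Ω → ℝ, MemLp R 2 P ∧
      (∀ ω, |hullPerimeter Z n ω - ∑ i ∈ Finset.range n, 2 * inner ℝ u (Z i ω)| ≤ R ω) ∧
      ∫ ω, R ω ^ 2 ∂P ≤ r * n + C := by
  set fy : Plane → ℝ := fun z => inner ℝ (perp u) z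
  set ft : Plane → ℝ := fun z => inner ℝ u z - m
  have hfy : Measurable fy := by fun_prop
  have hft : Measurable ft := by fun_prop
  have hyL2 : MemLp (fun ω => fy (Z 0 ω)) 2 P := hmoment.const_inner _
  have htL2 : MemLp (fun ω => ft (Z 0 ω)) 2 P := (hmoment.const_inner u).sub (memLp_const m)
  have hint : Integrable (Z 0) P := hmoment.integrable one_le_two
  have hymean : ∫ ω, fy (Z 0 ω) ∂P = 0 := by
    change ∫ ω, inner ℝ (perp u) (Z 0 ω) ∂P = 0
    rw [integral_inner hint, hmean, inner_smul_right, real_inner_comm, inner_perp_self, mul_zero]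
  have htmean : ∫ ω, ft (Z 0 ω) ∂P = 0 := by
    change ∫ ω, (inner ℝ u (Z 0 ω) - m) ∂P = 0
    rw [integral_sub ((hmoment.const_inner u).integrable one_le_two) (integrable_const _),
      integral_inner hint, hmean, inner_smul_right, real_inner_self_eq_norm_sq, hu]
    simp
  set V : ℝ := ∫ ω, fy (Z 0 ω) ^ 2 ∂P
  have hV : 0 ≤ V := integral_nonneg fun ω => sq_nonneg _
  -- Here `720 = 45 * 16`, from `5 * (3 * δ)²` and the maximal inequality; `V + 1` avoids dividing
  -- by a vanishing `V`. The budget `r` is spent as `r / 2` on `M` and `r / 4` on each kind of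
  -- excess.
  set δ : ℝ := √(r / (1440 * (V + 1)))
  have hδ : 0 < δ := Real.sqrt_pos.2 (by positivity)
  have hδV : 720 * δ ^ 2 * V ≤ r / 2 := by
    rw [Real.sq_sqrt (by positivity)]
    rw [show 720 * (r / (1440 * (V + 1))) * V = (r / 2) * (V / (V + 1)) by field_simp; ring]
    have : V / (V + 1) ≤ 1 := (div_le_one (by positivity)).2 (by linarith)
    nlinarith
  set ε₁ : ℝ := r / 4 / (40 * δ⁻¹ ^ 2)
  set ε₂ : ℝ := r / 4 / 40
  have hε₁ : 40 * δ⁻¹ ^ 2 * ε₁ = r / 4 := mul_div_cancel₀ _ (by positivity)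
  have hindy : iIndepFun (fun i ω => fy (Z i ω)) P := hindep.comp (fun _ => fy) fun _ => hfy
  have hindt : iIndepFun (fun i ω => ft (Z i ω)) P := hindep.comp (fun _ => ft) fun _ => hft
  have hidy : ∀ i, IdentDistrib (fun ω => fy (Z i ω)) (fun ω => fy (Z 0 ω)) P P := fun i =>
    (hident i).comp hfy
  have hidt : ∀ i, IdentDistrib (fun ω => ft (Z i ω)) (fun ω => ft (Z 0 ω)) P P := fun i =>
    (hident i).comp hft
  have hyL2' : ∀ i, MemLp (fun ω => fy (Z i ω)) 2 P := fun i => (hidy i).memLp_iff.2 hyL2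
  have htL2' : ∀ i, MemLp (fun ω => ft (Z i ω)) 2 P := fun i => (hidt i).memLp_iff.2 htL2
  obtain ⟨C₁, hC₁⟩ := exists_integral_partialSups_excess_sq_le
    (ξ := fun i ω => fy (Z i ω)) (fun i => hfy.comp (hmeas i)) hindy
    hidy hyL2 hymean (c := δ * (m / 2)) (ε := ε₁) (by positivity) (by positivity)
  obtain ⟨C₂, hC₂⟩ := exists_integral_partialSups_excess_sq_le
    (ξ := fun i ω => ft (Z i ω)) (fun i => hft.comp (hmeas i)) hindt
    hidt htL2 htmean (c := m / 2) (ε := ε₂) (by positivity) (by positivity)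
  refine ⟨40 * δ⁻¹ ^ 2 * C₁ + 40 * C₂, fun n => ?_⟩
  have hexc : ∀ {f : Plane → ℝ}, (∀ i, MemLp (fun ω => f (Z i ω)) 2 P) → ∀ (g : ℕ → ℕ) (c : ℝ),
      MemLp (fun ω => partialSups
        (fun j : ℕ => |∑ i ∈ Finset.range j, f (Z (g i) ω)| - c * j) n) 2 P :=
    fun hf g c => memLp_partialSups_apply
      (fun j => (memLp_finsetSum _ fun i _ => hf (g i)).abs.sub (memLp_const (c * j))) n
  have iAY := hexc hyL2' (fun i => i) (δ * (m / 2))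
  have iBY := hexc hyL2' (reflectBelow n) (δ * (m / 2))
  have iAT := hexc htL2' (fun i => i) (m / 2)
  have iBT := hexc htL2' (reflectBelow n) (m / 2)
  have iM := memLp_partialSups_apply (X := fun j ω => |∑ i ∈ Finset.range j, fy (Z i ω)|)
    (fun j => (memLp_finsetSum (Finset.range j) fun i _ => hyL2' i).abs) n
  have bAY := hC₁ (fun i => i) Function.injective_id n
  have bBY := hC₁ (reflectBelow n) (reflectBelow_injective n) n
  have bAT := hC₂ (fun i => i) Function.injective_id n
  have bBT := hC₂ (reflectBelow n) (reflectBelow_injective n) n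
  have bM := integral_partialSups_abs_sum_sq_le
    (ξ := fun i ω => fy (Z i ω)) (fun i => hfy.comp (hmeas i)) hindy hyL2'
    (fun i => (hidy i).integral_eq.trans hymean) n
  have hsum : ∑ i ∈ Finset.range n, ∫ ω, fy (Z i ω) ^ 2 ∂P = n * V := by
    have h : ∀ i, ∫ ω, fy (Z i ω) ^ 2 ∂P = V := fun i =>
      ((hident i).comp (hfy.pow_const 2)).integral_eq
    simp [h]
  rw [hsum] at bM
  set AY : Ω → ℝ := fun ω => partialSups
    (fun j : ℕ => |∑ i ∈ Finset.range j, fy (Z i ω)| - δ * (m / 2) * j) n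
  set BY : Ω → ℝ := fun ω => partialSups
    (fun j : ℕ => |∑ i ∈ Finset.range j, fy (Z (reflectBelow n i) ω)| - δ * (m / 2) * j) n
  set AT : Ω → ℝ := fun ω => partialSups
    (fun j : ℕ => |∑ i ∈ Finset.range j, ft (Z i ω)| - m / 2 * j) n
  set BT : Ω → ℝ := fun ω => partialSups
    (fun j : ℕ => |∑ i ∈ Finset.range j, ft (Z (reflectBelow n i) ω)| - m / 2 * j) n
  set M : Ω → ℝ := fun ω => partialSups (fun j => |∑ i ∈ Finset.range j, fy (Z i ω)|) n
  set R : Ω → ℝ := fun ω => 2 * (δ⁻¹ * (AY ω + BY ω) + (AT ω + BT ω)) + 3 * δ * M ω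
  have hR : MemLp R 2 P :=
    ((((iAY.add iBY).const_mul δ⁻¹).add (iAT.add iBT)).const_mul 2).add (iM.const_mul (3 * δ))
  refine ⟨R, hR, fun ω => ?_, ?_⟩
  · rw [abs_of_nonneg (sub_nonneg.2 (sum_two_mul_inner_le_hullPerimeter hu n ω))]
    exact hullPerimeter_sub_le hu hδ m n ω (fun _ => rfl) (fun _ => rfl)
  · have i1 : Integrable (fun ω => 20 * δ⁻¹ ^ 2 * (AY ω ^ 2 + BY ω ^ 2)) P :=
      (iAY.integrable_sq.add iBY.integrable_sq).const_mul _
    have i2 : Integrable (fun ω => 20 * (AT ω ^ 2 + BT ω ^ 2)) P :=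
      (iAT.integrable_sq.add iBT.integrable_sq).const_mul _
    have i12 : Integrable (fun ω => 20 * δ⁻¹ ^ 2 * (AY ω ^ 2 + BY ω ^ 2) +
        20 * (AT ω ^ 2 + BT ω ^ 2)) P := i1.add i2
    have i3 := iM.integrable_sq.const_mul (45 * δ ^ 2)
    have hle : ∫ ω, R ω ^ 2 ∂P ≤ ∫ ω, (20 * δ⁻¹ ^ 2 * (AY ω ^ 2 + BY ω ^ 2) +
        20 * (AT ω ^ 2 + BT ω ^ 2) + 45 * δ ^ 2 * M ω ^ 2) ∂P := by
      refine integral_mono hR.integrable_sq (i12.add i3) fun ω => ?_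
      -- Cauchy–Schwarz for five summands.
      have hcs : ∀ a b c d e : ℝ, (2 * (a + b + (c + d)) + e) ^ 2 ≤
          20 * (a ^ 2 + b ^ 2) + 20 * (c ^ 2 + d ^ 2) + 5 * e ^ 2 := fun a b c d e => by
        nlinarith [sq_nonneg (a - b), sq_nonneg (a - c), sq_nonneg (a - d), sq_nonneg (b - c),
          sq_nonneg (b - d), sq_nonneg (c - d), sq_nonneg (2 * a - e), sq_nonneg (2 * b - e),
          sq_nonneg (2 * c - e), sq_nonneg (2 * d - e)]
      have := hcs (δ⁻¹ * AY ω) (δ⁻¹ * BY ω) (AT ω) (BT ω) (3 * δ * M ω)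
      change (2 * (δ⁻¹ * (AY ω + BY ω) + (AT ω + BT ω)) + 3 * δ * M ω) ^ 2 ≤ _
      rw [mul_add δ⁻¹]
      refine this.trans (le_of_eq ?_)
      ring
    have heq : ∫ ω, (20 * δ⁻¹ ^ 2 * (AY ω ^ 2 + BY ω ^ 2) +
        20 * (AT ω ^ 2 + BT ω ^ 2) + 45 * δ ^ 2 * M ω ^ 2) ∂P =
        20 * δ⁻¹ ^ 2 * (∫ ω, AY ω ^ 2 ∂P + ∫ ω, BY ω ^ 2 ∂P) +
        20 * (∫ ω, AT ω ^ 2 ∂P + ∫ ω, BT ω ^ 2 ∂P) + 45 * δ ^ 2 * ∫ ω, M ω ^ 2 ∂P := by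
      rw [integral_add i12 i3, integral_add i1 i2, integral_const_mul, integral_const_mul,
        integral_const_mul, integral_add iAY.integrable_sq iBY.integrable_sq,
        integral_add iAT.integrable_sq iBT.integrable_sq]
    rw [heq] at hle
    have hδ2 : 0 < δ⁻¹ ^ 2 := by positivity
    have b1 : 20 * δ⁻¹ ^ 2 * (∫ ω, AY ω ^ 2 ∂P + ∫ ω, BY ω ^ 2 ∂P) ≤
        20 * δ⁻¹ ^ 2 * (2 * (ε₁ * n + C₁)) :=
      mul_le_mul_of_nonneg_left (by linarith) (by positivity)
    have b2 : 45 * δ ^ 2 * ∫ ω, M ω ^ 2 ∂P ≤ 45 * δ ^ 2 * (16 * (n * V)) :=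
      mul_le_mul_of_nonneg_left bM (by positivity)
    have b3 : 20 * δ⁻¹ ^ 2 * (2 * (ε₁ * n + C₁)) = r / 4 * n + 40 * δ⁻¹ ^ 2 * C₁ := by
      rw [← hε₁]
      ring
    have b4 : 45 * δ ^ 2 * (16 * (n * V)) ≤ r / 2 * n := by
      have := mul_le_mul_of_nonneg_right hδV (Nat.cast_nonneg (α := ℝ) n)
      linarith
    have b5 : 20 * (∫ ω, AT ω ^ 2 ∂P + ∫ ω, BT ω ^ 2 ∂P) ≤ r / 4 * n + 40 * C₂ := by
      have : ε₂ = r / 4 / 40 := rfl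
      rw [this] at bAT bBT
      linarith
    linarith

end Comparison

/-! ### Conclusion. -/

/-- As the mean is `m • u`, the numerator of `sigmaSq` carries a factor `m²`, cancelled by its
denominator. -/
theorem variance_two_mul_inner_eq_sigmaSq {Ω : Type*} [MeasurableSpace Ω] {P : Measure Ω}
    [IsProbabilityMeasure P] {X : Ω → Plane} (hX : MemLp X 2 P) {u : Plane} (hu : ‖u‖ = 1) {m : ℝ}
    (hm : 0 < m) (hmean : ∫ ω, X ω ∂P = m • u) :
    variance (fun ω => 2 * inner ℝ u (X ω)) P = sigmaSq P X := by
  rw [variance_eq_integral ((hX.const_inner u).const_mul 2).aestronglyMeasurable.aemeasurable,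
    integral_const_mul, integral_inner (hX.integrable one_le_two), sigmaSq, hmean, norm_smul, hu,
    Real.norm_of_nonneg hm.le, inner_smul_right, real_inner_self_eq_norm_sq, hu]
  rw [eq_div_iff (by positivity), ← integral_mul_const, ← integral_const_mul]
  refine integral_congr_ae (Eventually.of_forall fun ω => ?_)
  simp only [inner_sub_left, inner_smul_right, inner_smul_left, real_inner_self_eq_norm_sq, hu,
    conj_trivial, real_inner_comm u (X ω)]
  ring

theorem theorem1p2 {Ω : Type*} [MeasurableSpace Ω] (P : Measure Ω) [IsProbabilityMeasure P]
    (Z : ℕ → Ω → Plane) (hmeas : ∀ i, Measurable (Z i)) (hindep : iIndepFun Z P)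
    (hident : ∀ i, IdentDistrib (Z i) (Z 0) P P)
    (hmoment : MemLp (Z 0) 2 P)
    (hdrift : ‖∫ ω, Z 0 ω ∂P‖ ≠ 0)
    (hsigma : 0 < sigmaSq P (Z 0)) :
    (∀ n, MemLp (hullPerimeter Z n) 2 P) ∧
    ∀ x : ℝ,
      Tendsto (fun n : ℕ => P.real {ω |
          (hullPerimeter Z n ω - ∫ ω', hullPerimeter Z n ω' ∂P) /
            Real.sqrt (variance (hullPerimeter Z n) P) ≤ x})
        atTop (𝓝 (cdf (gaussianReal 0 1) x)) ∧
      Tendsto (fun n : ℕ => P.real {ω |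
          (hullPerimeter Z n ω - ∫ ω', hullPerimeter Z n ω' ∂P) /
            Real.sqrt (sigmaSq P (Z 0) * n) ≤ x})
        atTop (𝓝 (cdf (gaussianReal 0 1) x)) := by

  have hm : 0 < ‖∫ ω, Z 0 ω ∂P‖ := lt_of_le_of_ne (norm_nonneg _) hdrift.symm
  obtain ⟨u, hu, hmean⟩ : ∃ u : Plane, ‖u‖ = 1 ∧
      ∫ ω, Z 0 ω ∂P = ‖∫ ω, Z 0 ω ∂P‖ • u := by
    refine ⟨‖∫ ω, Z 0 ω ∂P‖⁻¹ • ∫ ω, Z 0 ω ∂P, ?_, ?_⟩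
    · rw [norm_smul, norm_inv, norm_norm, inv_mul_cancel₀ hdrift]
    · rw [smul_smul, mul_inv_cancel₀ hdrift, one_smul]
  have happrox := fun r (hr : 0 < r) =>
    exists_hullPerimeter_sub_le hmeas hindep hident hmoment hu hm hmean (r := r) hr
  have hf : Measurable fun z : Plane => 2 * (inner ℝ u z : ℝ) := by fun_prop
  set X : ℕ → Ω → ℝ := fun i ω => 2 * inner ℝ u (Z i ω)
  have hXident : ∀ i, IdentDistrib (X i) (X 0) P P := fun i => (hident i).comp hf
  have hXind : iIndepFun X P := hindep.comp (fun _ z => 2 * (inner ℝ u z : ℝ)) fun _ => hf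
  have hX : MemLp (X 0) 2 P := (hmoment.const_inner u).const_mul 2
  have hS : ∀ n, MemLp (fun ω => ∑ i ∈ Finset.range n, X i ω) 2 P := fun n =>
    memLp_finsetSum _ fun i _ => (hXident i).memLp_iff.2 hX
  have hvar : variance (X 0) P = sigmaSq P (Z 0) :=
    variance_two_mul_inner_eq_sigmaSq hmoment hu hm hmean
  have hLmeas := fun n => measurable_hullPerimeter Z n hmeas
  have hL : ∀ n, MemLp (hullPerimeter Z n) 2 P := by
    intro n
    -- Any positive `r` would do: only square integrability of the dominating `R` is used.
    obtain ⟨C, hC⟩ := happrox 1 one_pos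
    obtain ⟨R, hR, hle, -⟩ := hC n
    have hD : MemLp (fun ω => hullPerimeter Z n ω - ∑ i ∈ Finset.range n, X i ω) 2 P :=
      hR.mono' ((hLmeas n).aestronglyMeasurable.sub (hS n).aestronglyMeasurable)
        (Eventually.of_forall hle)
    have h := hD.add (hS n)
    have hfun : ((fun ω => hullPerimeter Z n ω - ∑ i ∈ Finset.range n, X i ω) +
        fun ω => ∑ i ∈ Finset.range n, X i ω) = hullPerimeter Z n := by
      ext ω
      simp
    rwa [hfun] at h
  have hD : Tendsto (fun n : ℕ =>
      (∫ ω, (hullPerimeter Z n ω - ∑ i ∈ Finset.range n, X i ω) ^ 2 ∂P) / n) atTop (𝓝 0) := by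
    rw [Metric.tendsto_atTop]
    intro r hr
    obtain ⟨C, hC⟩ := happrox (r / 2) (half_pos hr)
    -- Beyond `N` the constant satisfies `C < n * r / 2`, the other half of the budget.
    obtain ⟨N, hN⟩ := exists_nat_gt (2 * |C| / r)
    refine ⟨N + 1, fun n hn => ?_⟩
    have hn0 : (0 : ℝ) < n := by exact_mod_cast (by omega : 0 < n)
    have hNn : (N : ℝ) ≤ n := by exact_mod_cast (by omega : N ≤ n)
    obtain ⟨R, hR, hle, hint⟩ := hC n
    have h1 : ∫ ω, (hullPerimeter Z n ω - ∑ i ∈ Finset.range n, X i ω) ^ 2 ∂P ≤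
        ∫ ω, R ω ^ 2 ∂P := by
      refine integral_mono_of_nonneg (Eventually.of_forall fun ω => sq_nonneg _)
        hR.integrable_sq (Eventually.of_forall fun ω => ?_)
      exact sq_le_sq.2 ((hle ω).trans (le_abs_self _))
    rw [dist_zero_right, Real.norm_of_nonneg (div_nonneg
      (integral_nonneg fun ω => sq_nonneg _) hn0.le), div_lt_iff₀ hn0]
    have h2 : 2 * |C| < n * r := by
      rw [← div_lt_iff₀ hr]
      linarith
    have := le_abs_self C
    linarith
  have hv : 0 < variance (X 0) P := hvar ▸ hsigma
  refine ⟨hL, fun x => ⟨?_, ?_⟩⟩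
  · exact tendsto_real_standardized_le hv hX hXind hXident hL hD
      (tendsto_variance_div hX hXind hXident hL hD) x
  · refine tendsto_real_standardized_le hv hX hXind hXident hL hD
      (s := fun n => sigmaSq P (Z 0) * n) (tendsto_const_nhds.congr' ?_) x
    filter_upwards [eventually_gt_atTop 0] with n hn
    have hn0 : (n : ℝ) ≠ 0 := by exact_mod_cast hn.ne'
    rw [hvar, mul_div_cancel_right₀ _ hn0]
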